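/- Let $G$ be a finite group. For an integer $m$ coprime to $|G|$, let $\left(\frac{m}{G}\right)_{el}\in\{1,-1\}$ be the sign of the permutation $g\mapsto g^m$ of the set $G$. Let $f_2(G)=\{g\in G: g^2=1\}$, let $n_2(G)$ be the number of Sylow $2$-subgroups of $G$, let $\epsilon(G)=1$ if $|G|=2n_2(G)$ and $\epsilon(G)=0$ otherwise, and define the integer $$d_G=(-1)^{\frac{|G|-|f_2(G)|}{2}}\,\frac{|G|^{|f_2(G)|}}{n_2(G)^{\epsilon(G)}}.$$ Suppose that either $G$ is isomorphic to the direct product of a group of odd order and a $2$-group (either factor may be trivial), or $|G|=2n$ with $n$ odd and every element of $G$ of even order is an involution (has order $2$). Then $$\left(\frac{m}{G}\right)_{el}=\left(\frac{d_G}{m}\right)$$ for every integer $m$ with $\gcd(m,|G|)=1$. Here $\left(\frac{n}{a}\right)$, for $n,a\in\mathbb{Z}$, is the Kronecker symbol: it is multiplicative in $a$, it is the Legendre symbol when $a$ is an odd prime, $\left(\frac{n}{2}\right)$ is $0$ for even $n$, $1$ for $n\equiv 1,7\pmod 8$ and $-1$ for $n\equiv 3,5\pmod 8$, $\left(\frac{n}{-1}\right)$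 is $1$ for $n\ge 0$ and $-1$ for $n<0$, and $\left(\frac{n}{0}\right)$ is $1$ for $n=1$ and $0$ for $n\neq 1$. -/

import Mathlib

/-- The Kronecker symbol `(n / 2)`: `0` for even `n`, `1` for `n ≡ 1, 7 (mod 8)`, and `-1` for
`n ≡ 3, 5 (mod 8)`. -/
def kroneckerTwo (n : ℤ) : ℤ :=
  if n % 2 = 0 then 0 else if n % 8 = 1 ∨ n % 8 = 7 then 1 else -1

/-- The Kronecker symbol `(n / -1)`: `1` for `n ≥ 0` and `-1` for `n < 0`. -/
def kroneckerNegOne (n : ℤ) : ℤ := if n < 0 then -1 else 1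

/-- The Kronecker symbol `(n / a)` of two integers. For `a ≠ 0`, write `a = ± 2 ^ k * b` with `b`
odd and positive; then `(n / a)` is `(n / ± 1) * (n / 2) ^ k` times the Jacobi symbol `(n / b)`,
that is, the product of the Legendre symbols over the prime factors of `b` with multiplicity.
For `a = 0` it is `1` if `n = 1` and `0` otherwise. -/
def kroneckerSym (n a : ℤ) : ℤ :=
  if a = 0 then (if n = 1 then 1 else 0)
  else (if a < 0 then kroneckerNegOne n else 1)
    * kroneckerTwo n ^ (a.natAbs.factorization 2)
    * jacobiSym n (a.natAbs / 2 ^ (a.natAbs.factorization 2))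

/-- The set `f_k(G)` of the elements `g` of `G` with `g ^ k = 1`. -/
def powEqOne (G : Type*) [Group G] (k : ℕ) : Set G := {g | g ^ k = 1}

/-- The number `n₂(G)` of Sylow `2`-subgroups of `G`. -/
noncomputable def numSylowTwo (G : Type*) [Group G] : ℕ := Nat.card (Sylow 2 G)

/-- `ε(G)` is `1` if `|G| = 2 n₂(G)` and `0` otherwise. -/
noncomputable def epsGroup (G : Type*) [Group G] : ℕ :=
  if Nat.card G = 2 * numSylowTwo G then 1 else 0

/-- The integer `d_G = (-1) ^ ((|G| - |f₂(G)|) / 2) * |G| ^ |f₂(G)| / n₂(G) ^ ε(G)`. For a finite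
group both divisions are exact (`card_sub_card_powEqOne_even`, `numSylowTwo_pow_dvd`) and the
subtraction does not truncate, because `f₂(G)` is a subset of `G`. -/
noncomputable def dGroup (G : Type*) [Group G] : ℤ :=
  (-1) ^ ((Nat.card G - Nat.card (powEqOne G 2)) / 2) *
    ((Nat.card G ^ Nat.card (powEqOne G 2) / numSylowTwo G ^ epsGroup G : ℕ) : ℤ)

theorem card_sub_card_powEqOne_even (G : Type*) [Group G] [Finite G] :
    2 ∣ Nat.card G - Nat.card (powEqOne G 2) := by
  classical
  have := Fintype.ofFinite G
  let f : Function.End G := fun g : G => g⁻¹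
  have h2 : f ^ 2 ^ 1 = 1 := by
    rw [pow_one, pow_two]
    exact funext fun g => inv_inv g
  have h := Equiv.Perm.card_fixedPoints_modEq (p := 2) h2
  have hs : powEqOne G 2 = Function.fixedPoints f := by
    ext g
    change g ^ 2 = 1 ↔ g⁻¹ = g
    rw [pow_two, inv_eq_iff_mul_eq_one]
  rw [hs, Nat.card_eq_fintype_card, Nat.card_eq_fintype_card]
  exact (Nat.modEq_iff_dvd' (Fintype.card_subtype_le _)).1 h.symm

theorem numSylowTwo_pow_dvd (G : Type*) [Group G] [Finite G] :
    numSylowTwo G ^ epsGroup G ∣ Nat.card G ^ Nat.card (powEqOne G 2) := by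
  have : Nonempty (powEqOne G 2) := ⟨⟨1, by simp [powEqOne]⟩⟩
  have h0 : Nat.card (powEqOne G 2) ≠ 0 := Nat.card_pos.ne'
  unfold epsGroup
  split_ifs with h
  · rw [pow_one]
    exact (Dvd.intro_left 2 h.symm).trans (dvd_pow_self _ h0)
  · simp

theorem zpow_bijective_of_isCoprime (G : Type*) [Group G] [Finite G] (m : ℤ)
    (hm : IsCoprime m (Nat.card G : ℤ)) : Function.Bijective (fun g : G => g ^ m) := by
  rw [← Finite.injective_iff_bijective]
  obtain ⟨a, b, hab⟩ := hm
  have key : ∀ g : G, (g ^ m) ^ a = g := fun g => by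
    rw [← zpow_mul]
    calc g ^ (m * a) = g ^ (m * a) * (g ^ ((Nat.card G : ℤ))) ^ b := by simp
      _ = g ^ (a * m + b * (Nat.card G : ℤ)) := by
        rw [← zpow_mul, ← zpow_add]; congr 1; ring
      _ = g := by rw [hab, zpow_one]
  intro g h hgh
  rw [← key g, ← key h]
  exact congrArg (· ^ a) hgh

/-- The permutation `g ↦ g ^ m` of a finite group `G`, for `m` coprime to `|G|`. -/
noncomputable def powPerm (G : Type*) [Group G] [Finite G] (m : ℤ)
    (hm : IsCoprime m (Nat.card G : ℤ)) : Equiv.Perm G :=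
  Equiv.ofBijective (fun g : G => g ^ m) (zpow_bijective_of_isCoprime G m hm)

/-- `G` is (isomorphic to) the direct product of a group of odd order and a `2`-group. -/
def IsOddTimesTwoGroup.{u} (G : Type u) [Group G] : Prop :=
  ∃ (K H : Type u) (_ : Group K) (_ : Group H),
    Odd (Nat.card K) ∧ IsPGroup 2 H ∧ Nonempty (G ≃* K × H)

/-- `G` has order `2 n` with `n` odd, and all elements of `G` of even order are involutions. -/
def IsTwiceOddWithInvolutions (G : Type*) [Group G] : Prop :=
  (∃ n : ℕ, Odd n ∧ Nat.card G = 2 * n) ∧ ∀ g : G, Even (orderOf g) → orderOf g = 2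

/-! The heart is the case of odd order, where the sign of `g ↦ g ^ m` is the Jacobi symbol of `m`
over |G|. A group of odd order has no real class except {1}, and its classes have odd size. A Gauss
lemma for permutations commuting with an involution (`sign_eq_prod_half_system`) then shows that the
power map has the same sign on G as on its conjugacy classes.

By Dirichlet's theorem `m` may be replaced by a prime q > |G|. Over an algebraic closure of F_q,
consider the table of normalized characters χ(g) / χ(1), defined without representations as the
scalar solutions of the functional equation `IsSpherical`. Frobenius sends the column of g to the
column of g ^ q, so the determinant D of the table satisfies D ^ q = ± D, the sign being that of the
permutation of classes. Orthogonality makes D ^ 2, up to squares in F_q, equal to ± |G|, with the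
sign of inversion on classes. So the wanted sign is the Legendre symbol of ± |G| at q, and quadratic
reciprocity turns it into the Jacobi symbol.

For an odd group times a nontrivial 2-group the sign depends only on `m` mod 4, and d_G is ± a
square. If |G| = 2n and all elements of even order are involutions, then everything outside the
subgroup N of index 2 is fixed, the sign is that on N, and d_G is (-1) ^ ((n - 1) / 2) * n times a
square. -/

open Equiv Equiv.Perm

/-! ### Gauss's lemma for involutions, and power maps on conjugacy classes -/

section HalfSystem

/-- A generalization of Gauss's lemma: for a permutation `σ` commuting with an involution `i` and
fixing the fixed points of `i`, the sign is the product of the sign changes on a half system. -/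
theorem sign_eq_prod_half_system {X : Type*} [Fintype X] [DecidableEq X] (i : X → X)
    (hi : Function.Involutive i) (σ : Perm X) (hσ : ∀ x, σ (i x) = i (σ x))
    (hfix : ∀ x, i x = x → σ x = x) (ε : X → ℤˣ) (hε : ∀ x, i x ≠ x → ε (i x) = -ε x) :
    sign σ = ∏ x with i x ≠ x ∧ ε x = 1, ε (σ x) := by
  have hnf : ∀ x, i (σ x) = σ x ↔ i x = x := fun x => by
    rw [← hσ, σ.injective.eq_iff]
  have hcases : ∀ u v : ℤˣ, u ≠ v → u = -v := by decide
  -- `t` flips the pairs {x, i x} on which `σ` changes `ε`. Then `ρ = σ * τ` preserves `ε` and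
  -- commutes with `i`, so it acts in the same way on both halves and is even.
  let t : X → X := fun x => if ε (σ x) ≠ ε x then i x else x
  have ht : Function.Involutive t := by
    intro x
    by_cases hx : i x = x
    · simp only [t, hx, ite_self]
    · by_cases h : ε (σ x) = ε x
      · simp [t, h]
      · have h' : ε (σ (i x)) ≠ ε (i x) := by
          rw [hσ, hε x hx, hε _ (by rwa [Ne, hnf])]
          simpa using h
        simp only [t, ne_eq, h, not_false_eq_true, if_true, h']
        exact hi x
  let τ : Perm X := ht.toPerm
  have hτ : ∀ x, τ x = t x := fun x => rfl
  let ρ : Perm X := σ * τ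
  have hρi : ∀ x, ρ (i x) = i (ρ x) := by
    intro x
    change σ (t (i x)) = i (σ (t x))
    rw [← hσ]
    congr 1
    by_cases hx : i x = x
    · simp [t, hx]
    · simp only [t]
      rw [hσ, hε x hx, hε _ (by rwa [Ne, hnf])]
      simp only [ne_eq, neg_inj]
      split_ifs <;> simp
  have hρε : ∀ x, ε (ρ x) = ε x := by
    intro x
    change ε (σ (t x)) = _
    by_cases hx : i x = x
    · simp [t, hx, hfix]
    · by_cases h : ε (σ x) = ε x
      · simp [t, h]
      · simp only [t, ne_eq, h, not_false_eq_true, if_true]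
        rw [hσ, hε _ (by rwa [Ne, hnf]), hcases _ _ h, neg_neg]
  have hρfix : ∀ x, i x = x → ρ x = x := by
    intro x hx
    change σ (t x) = x
    simp [t, hx, hfix]
  have hρnf : ∀ x, i (ρ x) = ρ x ↔ i x = x := fun x => by
    rw [← hρi, ρ.injective.eq_iff]
  let p : X → Prop := fun x => i x ≠ x ∧ ε x = 1
  have hp : ∀ x, p (ρ x) ↔ p x := fun x => by simp only [p, ne_eq, hρnf, hρε]
  let a : Perm X := ofSubtype (ρ.subtypePerm hp)
  let b : Perm X := hi.toPerm * a * hi.toPerm⁻¹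
  have hab : ρ = b * a := by
    ext x
    have hb : ∀ y, b y = i (a (i y)) := fun y => rfl
    change ρ x = b (a x)
    rw [hb]
    by_cases hx : i x = x
    · have h1 : ¬ p x := fun h => h.1 hx
      rw [ofSubtype_apply_of_not_mem _ h1, hx, ofSubtype_apply_of_not_mem _ h1, hx, hρfix x hx]
    · by_cases h : ε x = 1
      · have h1 : p x := ⟨hx, h⟩
        have h2 : a x = ρ x := by
          rw [ofSubtype_apply_of_mem _ h1]; rfl
        have h3 : ¬ p (i (ρ x)) := by
          rintro ⟨-, h4⟩
          rw [hε _ (by rwa [Ne, hρnf]), hρε, h] at h4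
          exact absurd h4 (by decide)
        rw [h2, ofSubtype_apply_of_not_mem _ h3, hi]
      · have h1 : ¬ p x := fun h' => h h'.2
        have h2 : p (i x) := by
          refine ⟨fun h' => hx ?_, ?_⟩
          · rw [hi] at h'; exact h'.symm
          · rw [hε x hx, hcases _ _ h, neg_neg]
        rw [ofSubtype_apply_of_not_mem _ h1, ofSubtype_apply_of_mem _ h2]
        change ρ x = i (ρ (i x))
        rw [hρi, hi]
  have hsρ : sign ρ = 1 := by
    rw [hab]
    rw [Perm.sign_mul, show sign b = sign a by
      rw [Perm.sign_mul, Perm.sign_mul, sign_inv, mul_right_comm, Int.units_mul_self, one_mul],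
      Int.units_mul_self]
  have hsσ : sign σ = sign τ := by
    have h1 : sign σ * sign τ = 1 := by rw [← Perm.sign_mul]; exact hsρ
    rw [← mul_one (sign σ), ← Int.units_mul_self (sign τ), ← mul_assoc, h1, one_mul]
  -- One representative for each transposition (x, i x) occurring in `τ`; the sign of `τ` is (-1) ^
  -- |T|.
  let T : Finset X := {x | p x ∧ ε (σ x) ≠ ε x}
  have hsupp : τ.support = T ∪ T.image i := by
    ext x
    rw [mem_support, hτ]
    simp only [t, T, p, Finset.mem_union, Finset.mem_filter, Finset.mem_univ, true_and,
      Finset.mem_image, ne_eq]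
    constructor
    · intro h
      have h1 : ε (σ x) ≠ ε x := fun h1 => h (by simp [h1])
      have hx : i x ≠ x := by simpa [h1] using h
      by_cases h2 : ε x = 1
      · exact Or.inl ⟨⟨hx, h2⟩, h1⟩
      · refine Or.inr ⟨i x, ⟨⟨fun h' => hx ?_, ?_⟩, ?_⟩, hi x⟩
        · rw [hi] at h'; exact h'.symm
        · rw [hε x hx, hcases _ _ h2, neg_neg]
        · rw [hσ, hε x hx, hε _ (by rwa [Ne, hnf])]
          simpa using h1
    · rintro (⟨⟨h1, h2⟩, h3⟩ | ⟨y, ⟨⟨h1, h2⟩, h3⟩, rfl⟩)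
      · simpa [h3] using h1
      · have h4 : ¬ ε (σ (i y)) = ε (i y) := by
          rw [hσ, hε y h1, hε _ (by rwa [Ne, hnf])]
          simpa using h3
        rw [if_pos h4, hi]
        exact fun h => h1 h.symm
  have hdisj : Disjoint T (T.image i) := by
    rw [Finset.disjoint_left]
    intro x hx hx'
    obtain ⟨y, hy, rfl⟩ := Finset.mem_image.1 hx'
    simp only [T, p, Finset.mem_filter, Finset.mem_univ, true_and] at hx hy
    have := hx.1.2
    rw [hε y hy.1.1, hy.1.2] at this
    exact absurd this (by decide)
  have hτ2 : τ ^ 2 = 1 := by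
    ext x
    rw [pow_two, Perm.mul_apply]
    exact ht x
  rw [hsσ, sign_of_pow_two_eq_one hτ2, card_fixedPoints,
    sum_cycleType, Nat.sub_sub_self (Finset.card_le_univ _), hsupp,
    Finset.card_union_of_disjoint hdisj,
    Finset.card_image_of_injective _ hi.injective, ← two_mul, Nat.mul_div_cancel_left _ two_pos]
  rw [Finset.card_eq_sum_ones, Finset.prod_pow_eq_pow_sum T (fun _ => 1) (-1 : ℤˣ) |>.symm]
  simp only [pow_one]
  have hT : T = (Finset.univ.filter p).filter (fun x => ε (σ x) ≠ ε x) := by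
    ext x; simp [T]
  rw [hT, Finset.prod_filter]
  refine Finset.prod_congr rfl fun x hx => ?_
  have h1 : ε x = 1 := (Finset.mem_filter.1 hx).2.2
  split_ifs with h
  · rw [h1] at h; exact (hcases _ _ h).symm
  · rw [not_not.1 h, h1]

/-- A half system for an involution with a unique fixed point. -/
theorem exists_half_system {X : Type*} [Fintype X] [DecidableEq X] (i : X → X)
    (hi : Function.Involutive i) (x₀ : X) (hfix : ∀ x, i x = x ↔ x = x₀) :
    ∃ S : Finset X, ∀ {R : Type} [CommMonoid R] (f : X → R), (∀ x, f (i x) = f x) →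
      ∏ x, f x = f x₀ * (∏ x ∈ S, f x) ^ 2 ∧
      ∀ σ : Perm X, (∀ x, σ (i x) = i (σ x)) → ∏ x ∈ S, f (σ x) = ∏ x ∈ S, f x := by
  classical
  let o : LinearOrder X := LinearOrder.lift' (Fintype.equivFin X) (Fintype.equivFin X).injective
  have hmin : ∀ x, i x ≠ x → min x (i x) < i (min x (i x)) := by
    intro x hx
    rcases lt_or_gt_of_ne hx with h | h
    · rw [min_eq_right h.le, hi]; exact h
    · rw [min_eq_left h.le]; exact h
  have hmini : ∀ x, min (i x) (i (i x)) = min x (i x) := fun x => by rw [hi, min_comm]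
  have hlt : ∀ x, x < i x → min x (i x) = x := fun x h => min_eq_left h.le
  obtain ⟨S, hS⟩ : ∃ S : Finset X, ∀ x, x ∈ S ↔ x < i x :=
    ⟨Finset.univ.filter fun x => x < i x, by simp⟩
  refine ⟨S, fun f hf => ⟨?_, fun σ hσ => ?_⟩⟩
  · have h1 : (Finset.univ : Finset X) = insert x₀ (S ∪ S.image i) := by
      ext x
      simp only [Finset.mem_univ, Finset.mem_insert, Finset.mem_union, hS,
        Finset.mem_image, true_iff]
      rcases lt_trichotomy x (i x) with h | h | h
      · exact Or.inr (Or.inl h)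
      · exact Or.inl ((hfix x).1 h.symm)
      · exact Or.inr (Or.inr ⟨i x, by rwa [hi], hi x⟩)
    rw [h1, Finset.prod_insert, Finset.prod_union,
      Finset.prod_image (fun _ _ _ _ h => hi.injective h),
      Finset.prod_congr rfl (fun x _ => hf x), pow_two]
    · rw [Finset.disjoint_left]
      intro x hx hx'
      obtain ⟨y, hy, rfl⟩ := Finset.mem_image.1 hx'
      simp only [hS, hi y] at hx hy
      exact lt_asymm hx hy
    · simp only [Finset.mem_union, hS,
        Finset.mem_image, not_or, (hfix x₀).2 rfl, lt_irrefl, not_false_eq_true, not_exists, not_and]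
      refine ⟨trivial, fun y hy h => ?_⟩
      have : y = x₀ := by rw [← hi y, h, (hfix x₀).2 rfl]
      rw [this, (hfix x₀).2 rfl] at hy
      exact lt_irrefl _ hy
  · have hfm : ∀ x, f (min x (i x)) = f x := by
      intro x
      rcases min_choice x (i x) with h | h <;> rw [h]
      exact hf x
    have hσ' : ∀ x, σ.symm (i x) = i (σ.symm x) := fun x => by
      rw [Equiv.symm_apply_eq, hσ, Equiv.apply_symm_apply]
    have key : ∀ τ τ' : Perm X, (∀ x, τ (i x) = i (τ x)) → (∀ x, τ' (i x) = i (τ' x)) →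
        (∀ x, τ' (τ x) = x) → ∀ x, x < i x →
        min (τ' (min (τ x) (i (τ x)))) (i (τ' (min (τ x) (i (τ x))))) = x := by
      intro τ τ' _ h2 h3 x hx
      rcases min_choice (τ x) (i (τ x)) with h | h <;> rw [h]
      · rw [h3, hlt x hx]
      · rw [h2, h3, hmini, hlt x hx]
    have hne : ∀ (τ : Perm X), (∀ x, τ (i x) = i (τ x)) → ∀ x, x < i x → i (τ x) ≠ τ x :=
      fun τ hτ x hx h => hx.ne' (τ.injective ((hτ x).trans h))
    -- `σ` carries `S` to another set of representatives of the pairs. Taking the smaller member of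
    -- each pair returns to `S`, and `f` does not see the difference.
    refine Finset.prod_nbij' (fun x => min (σ x) (i (σ x)))
      (fun x => min (σ.symm x) (i (σ.symm x))) ?_ ?_ ?_ ?_ ?_
    · intro x hx
      rw [hS] at hx ⊢
      exact hmin _ (hne σ hσ x hx)
    · intro x hx
      rw [hS] at hx ⊢
      exact hmin _ (hne _ hσ' x hx)
    · intro x hx
      exact key σ σ.symm hσ hσ' (by simp) x ((hS x).1 hx)
    · intro x hx
      exact key σ.symm σ hσ' hσ (by simp) x ((hS x).1 hx)
    · intro x _
      exact (hfm _).symm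

variable {G : Type*} [Group G]

@[simp]
theorem powPerm_apply [Finite G] (m : ℤ) (hm : IsCoprime m (Nat.card G : ℤ)) (g : G) :
    powPerm G m hm g = g ^ m := rfl

theorem IsConj.zpow_zpow {x y : G} (h : IsConj x y) (m : ℤ) : IsConj (x ^ m) (y ^ m) := by
  obtain ⟨c, rfl⟩ := isConj_iff.1 h
  exact isConj_iff.2 ⟨c, by rw [conj_zpow]⟩

/-- The map on conjugacy classes induced by `g ↦ g ^ m`. -/
def ConjClasses.zpowMap (m : ℤ) : ConjClasses G → ConjClasses G :=
  Quotient.map' (· ^ m) fun _ _ h => h.zpow_zpow m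

@[simp]
theorem ConjClasses.zpowMap_mk (m : ℤ) (g : G) :
    ConjClasses.zpowMap m (ConjClasses.mk g) = ConjClasses.mk (g ^ m) := rfl

theorem ConjClasses.zpowMap_comm (m k : ℤ) (c : ConjClasses G) :
    ConjClasses.zpowMap m (ConjClasses.zpowMap k c) =
      ConjClasses.zpowMap k (ConjClasses.zpowMap m c) := by
  obtain ⟨g, rfl⟩ := ConjClasses.mk_surjective c
  simp only [zpowMap_mk, ← zpow_mul, mul_comm]

theorem ConjClasses.zpowMap_neg_one_involutive :
    Function.Involutive (ConjClasses.zpowMap (G := G) (-1)) := by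
  intro c
  obtain ⟨g, rfl⟩ := ConjClasses.mk_surjective c
  simp

/-- The permutation of the conjugacy classes induced by `g ↦ g ^ m`, for `m` coprime to `|G|`. -/
noncomputable def ConjClasses.zpowPerm [Finite G] (m : ℤ) (hm : IsCoprime m (Nat.card G : ℤ)) :
    Perm (ConjClasses G) :=
  Equiv.ofBijective (ConjClasses.zpowMap m) <| by
    rw [← Finite.surjective_iff_bijective]
    intro c
    obtain ⟨g, rfl⟩ := ConjClasses.mk_surjective c
    obtain ⟨h, rfl⟩ := (zpow_bijective_of_isCoprime G m hm).2 g
    exact ⟨ConjClasses.mk h, rfl⟩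

@[simp]
theorem ConjClasses.zpowPerm_apply [Finite G] (m : ℤ) (hm : IsCoprime m (Nat.card G : ℤ))
    (c : ConjClasses G) : ConjClasses.zpowPerm m hm c = ConjClasses.zpowMap m c := rfl

theorem pow_two_eq_one_iff_of_odd_card (hG : Odd (Nat.card G)) (g : G) : g ^ 2 = 1 ↔ g = 1 := by
  have : (Nat.card G).Coprime 2 := hG.coprime_two_right
  constructor
  · intro h
    exact (powCoprime this).injective (by simpa [powCoprime] using h)
  · rintro rfl; simp

/-- If x inverts g, then x ^ 2 centralizes g. In odd order x is a power of x ^ 2, so x centralizes g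
too, whence g = g⁻¹ and g = 1. -/
theorem ConjClasses.zpowMap_neg_one_eq_iff (hG : Odd (Nat.card G)) (c : ConjClasses G) :
    ConjClasses.zpowMap (-1) c = c ↔ c = 1 := by
  obtain ⟨g, rfl⟩ := ConjClasses.mk_surjective c
  rw [zpowMap_mk, zpow_neg_one, ConjClasses.one_eq_mk_one, ConjClasses.mk_eq_mk_iff_isConj,
    ConjClasses.mk_eq_mk_iff_isConj]
  constructor
  · intro h
    obtain ⟨x, hx⟩ := isConj_iff.1 h
    have hc : (Nat.card G).Coprime 2 := hG.coprime_two_right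
    have hx' : x * g * x⁻¹ = g⁻¹ := by
      conv_rhs => rw [← hx]
      simp [mul_assoc]
    have h2 : Commute (x ^ 2) g := by
      have : x ^ 2 * g * (x ^ 2)⁻¹ = g := by
        calc x ^ 2 * g * (x ^ 2)⁻¹ = x * (x * g * x⁻¹) * x⁻¹ := by simp [pow_two, mul_assoc]
          _ = x * g⁻¹ * x⁻¹ := by rw [hx']
          _ = g := hx
      exact mul_inv_eq_iff_eq_mul.1 this
    have h1 : Commute x g := by
      obtain ⟨k, hk⟩ := hG
      have : x = (x ^ 2) ^ (k + 1) := by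
        rw [← pow_mul, show 2 * (k + 1) = Nat.card G + 1 by omega, pow_succ, pow_card_eq_one',
          one_mul]
      rw [this]
      exact h2.pow_left _
    have hg : g ^ 2 = 1 := by
      rw [h1.eq, mul_inv_cancel_right] at hx'
      rw [pow_two]
      nth_rewrite 1 [hx']
      exact inv_mul_cancel g
    rw [(pow_two_eq_one_iff_of_odd_card hG g).1 hg]
  · intro h
    rw [isConj_one_left.1 h]
    simp

theorem ConjClasses.odd_card_carrier [Finite G] (hG : Odd (Nat.card G)) (c : ConjClasses G) :
    Odd (Nat.card c.carrier) := by
  classical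
  have := Fintype.ofFinite G
  obtain ⟨g, rfl⟩ := ConjClasses.mk_surjective c
  refine hG.of_dvd_nat ?_
  rw [Nat.card_eq_fintype_card, ConjClasses.card_carrier, Nat.card_eq_fintype_card]
  refine Nat.div_dvd_of_dvd ?_
  have := Subgroup.card_subgroup_dvd_card (MulAction.stabilizer (ConjAct G) g)
  rwa [Nat.card_eq_fintype_card, Nat.card_eq_fintype_card, ConjAct.card] at this

/-- In a group of odd order, `g ↦ g ^ m` has the same sign on elements and on conjugacy classes. -/
theorem sign_powPerm_eq_sign_zpowPerm [Fintype G] [DecidableEq G] [Fintype (ConjClasses G)]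
    [DecidableEq (ConjClasses G)] (hG : Odd (Nat.card G)) (m : ℤ)
    (hm : IsCoprime m (Nat.card G : ℤ)) :
    sign (powPerm G m hm) = sign (ConjClasses.zpowPerm m hm) := by
  classical
  -- One sign function on classes serves both computations: it pulls back to G because no g ≠ 1 is
  -- conjugate to its inverse.
  obtain ⟨ε, hε⟩ : ∃ ε : ConjClasses G → ℤˣ, ∀ c, ConjClasses.zpowMap (-1) c ≠ c →
      ε (ConjClasses.zpowMap (-1) c) = -ε c := by
    let o : LinearOrder (ConjClasses G) :=
      LinearOrder.lift' (Fintype.equivFin _) (Fintype.equivFin _).injective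
    refine ⟨fun c => if c < ConjClasses.zpowMap (-1) c then 1 else -1, fun c hc => ?_⟩
    dsimp only
    rw [ConjClasses.zpowMap_neg_one_involutive c]
    rcases lt_or_gt_of_ne hc with h | h
    · rw [if_pos h, if_neg (not_lt_of_gt h), neg_neg]
    · rw [if_neg (not_lt_of_gt h), if_pos h]
  have hinv : ∀ g : G, g⁻¹ = g ↔ g = 1 := fun g => by
    rw [← pow_two_eq_one_iff_of_odd_card hG, pow_two, inv_eq_iff_mul_eq_one]
  have hcl : ∀ g : G, ConjClasses.zpowMap (-1) (ConjClasses.mk g) = ConjClasses.mk g ↔ g = 1 :=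
    fun g => by
      rw [ConjClasses.zpowMap_neg_one_eq_iff hG, ConjClasses.one_eq_mk_one,
        ConjClasses.mk_eq_mk_iff_isConj, isConj_one_left]
  rw [sign_eq_prod_half_system (fun g : G => g⁻¹) inv_inv (powPerm G m hm)
      (fun g => by simp) (fun g hg => by simp [(hinv g).1 hg])
      (fun g => ε (ConjClasses.mk g)) (fun g hg => by
        have := hε (ConjClasses.mk g) (by rwa [Ne, hcl, ← hinv])
        rwa [ConjClasses.zpowMap_mk, zpow_neg_one] at this),
    sign_eq_prod_half_system _ ConjClasses.zpowMap_neg_one_involutive (ConjClasses.zpowPerm m hm)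
      (fun c => ConjClasses.zpowMap_comm _ _ _) (fun c hc => by
        rw [(ConjClasses.zpowMap_neg_one_eq_iff hG c).1 hc]; simp [ConjClasses.one_eq_mk_one]) ε hε]
  -- Grouped by class, each factor on classes occurs in the product over G to the power of the class
  -- size, which is odd.
  rw [← Finset.prod_fiberwise_of_maps_to (g := ConjClasses.mk)
    (t := Finset.univ.filter fun c => ConjClasses.zpowMap (-1) c ≠ c ∧ ε c = 1)]
  · refine Finset.prod_congr rfl fun c hc => ?_
    rw [Finset.prod_congr rfl (g := fun _ => ε (ConjClasses.zpowPerm m hm c)), Finset.prod_const]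
    · have hcard : Finset.card (Finset.filter (fun g : G => ConjClasses.mk g = c)
          (Finset.univ.filter fun g : G => g⁻¹ ≠ g ∧ ε (ConjClasses.mk g) = 1)) =
          Nat.card c.carrier := by
        rw [Nat.card_eq_fintype_card, ← Set.toFinset_card]
        congr 1
        ext g
        simp only [Finset.mem_filter, Finset.mem_univ, true_and, Set.mem_toFinset,
          ConjClasses.mem_carrier_iff_mk_eq, and_iff_right_iff_imp]
        rintro rfl
        have := (Finset.mem_filter.1 hc).2
        exact ⟨by rw [Ne, hinv, ← hcl]; exact this.1, this.2⟩
      rw [hcard]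
      obtain ⟨k, hk⟩ := ConjClasses.odd_card_carrier hG c
      rw [hk, pow_succ, pow_mul, pow_two, Int.units_mul_self, one_pow, one_mul]
    · intro g hg
      rw [← (Finset.mem_filter.1 hg).2]
      rfl
  · intro g hg
    have := (Finset.mem_filter.1 hg).2
    simp only [Finset.mem_filter, Finset.mem_univ, true_and]
    exact ⟨by rw [Ne, hcl, ← hinv]; exact this.1, this.2⟩

end HalfSystem

/-! ### Spherical functions and Frobenius -/

section Spherical

/-- On each level set of `F` the orbits of `r` have size 1 or q, and those of size q contribute 0 in
characteristic q. -/
theorem sum_eq_sum_fixedPoints {X E : Type*} [Fintype X] [DecidableEq X] [Ring E] (q : ℕ)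
    [hq : Fact q.Prime] [CharP E q] (r : X → X) (hr : r^[q] = id) (F : X → E)
    (hF : ∀ x, F (r x) = F x) : ∑ x, F x = ∑ x with r x = x, F x := by
  classical
  have h1 := Finset.sum_fiberwise_of_maps_to (s := Finset.univ) (t := Finset.univ.image F) (g := F)
    (fun x _ => Finset.mem_image_of_mem _ (Finset.mem_univ x)) F
  have h2 := Finset.sum_fiberwise_of_maps_to (s := Finset.univ.filter fun x => r x = x)
    (t := Finset.univ.image F) (g := F)
    (fun x _ => Finset.mem_image_of_mem _ (Finset.mem_univ x)) F
  rw [← h1, ← h2]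
  refine Finset.sum_congr rfl fun v _ => ?_
  have hc : ∀ s : Finset X, ∑ x ∈ s with F x = v, F x = ((s.filter fun x => F x = v).card : E) * v :=
    fun s => by
      rw [Finset.sum_congr rfl fun x hx => (Finset.mem_filter.1 hx).2, Finset.sum_const,
        nsmul_eq_mul]
  rw [hc, hc]
  congr 1
  let f : Function.End {x : X // F x = v} := fun x => ⟨r x.1, by rw [hF, x.2]⟩
  have hf : ∀ (k : ℕ) x, ((f ^ k) x).1 = r^[k] x.1 := by
    intro k
    induction k with
    | zero => intro x; rfl
    | succ k ih =>
      intro x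
      rw [pow_succ, Function.iterate_succ_apply]
      exact ih (f x)
  have hf1 : f ^ q ^ 1 = 1 := by
    funext x
    rw [pow_one]
    apply Subtype.ext
    rw [hf, hr]
    rfl
  have key := card_fixedPoints_modEq hf1
  rw [← (CharP.natCast_eq_natCast E q (a := _) (b := _))] at key
  convert key using 2
  · rw [Fintype.card_subtype]
  · have : Fintype.card (Function.fixedPoints f) = Fintype.card {x // r x = x ∧ F x = v} := by
      refine Fintype.card_congr ⟨fun x => ⟨x.1.1, ?_, x.1.2⟩, fun x => ⟨⟨x.1, x.2.2⟩, ?_⟩, ?_, ?_⟩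
      · exact congrArg Subtype.val x.2
      · exact Subtype.ext x.2.1
      · intro x; rfl
      · intro x; rfl
    rw [this, Fintype.card_subtype, Finset.filter_filter]

variable {G : Type*} [Group G] [Fintype G]

/-- A spherical function on a finite group for the conjugation action, with values in a ring: a
normalized solution of `|G| T(a) T(b) = ∑ h, T(a h b h⁻¹)`. -/
structure IsSpherical {E : Type*} [Ring E] (T : G → E) : Prop where
  map_one : T 1 = 1
  card_mul_mul : ∀ a b, (Fintype.card G : E) * (T a * T b) = ∑ h, T (a * (h * b * h⁻¹))

namespace IsSpherical

variable {E : Type*} [Ring E] {T : G → E}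

theorem map_conj (hT : IsSpherical T) (hn : IsUnit (Fintype.card G : E)) (h b : G) :
    T (h * b * h⁻¹) = T b := by
  have key : ∀ b, (Fintype.card G : E) * T b = ∑ h, T (h * b * h⁻¹) := fun b => by
    simpa [hT.map_one] using hT.card_mul_mul 1 b
  apply hn.mul_left_cancel
  rw [key, key]
  refine Fintype.sum_equiv (Equiv.mulRight h) _ _ fun k => ?_
  simp [mul_assoc]

/-- The element a h b h⁻¹ is conjugate to b h⁻¹ a h, which makes the functional equation symmetric.
-/
theorem commute (hT : IsSpherical T) (hn : IsUnit (Fintype.card G : E)) (a b : G) :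
    Commute (T a) (T b) := by
  apply hn.mul_left_cancel
  rw [hT.card_mul_mul, hT.card_mul_mul]
  refine Fintype.sum_equiv (Equiv.inv G) _ _ fun h => ?_
  rw [← hT.map_conj hn (b * h⁻¹)]
  simp [mul_assoc]

theorem card_pow_mul_pow (hT : IsSpherical T) (x : G) (j : ℕ) (a : G) :
    (Fintype.card G : E) ^ j * (T a * T x ^ j) =
      ∑ f : Fin j → G, T (a * (List.ofFn fun i => f i * x * (f i)⁻¹).prod) := by
  induction j generalizing a with
  | zero => simp
  | succ j ih =>
    have h1 : (Fintype.card G : E) ^ (j + 1) * (T a * T x ^ (j + 1)) =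
        (Fintype.card G : E) ^ j * (((Fintype.card G : E) * (T a * T x)) * T x ^ j) := by
      rw [pow_succ, pow_succ' (T x)]; simp only [mul_assoc]
    rw [h1, hT.card_mul_mul, Finset.sum_mul, Finset.mul_sum,
      Finset.sum_congr rfl fun h _ => ih _, ← Finset.sum_product', Finset.univ_product_univ]
    refine Fintype.sum_equiv (Fin.consEquiv fun _ => G) _ _ fun f => ?_
    simp [List.ofFn_succ, Fin.consEquiv, mul_assoc]

-- Expand T(x) ^ q as a sum over q-tuples of conjugators. Rotating a tuple cyclically conjugates the
-- product, so only constant tuples survive in characteristic q, and each of them gives T(x ^ q).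
-- The powers of |G| match because |G| ^ q = |G| in F_q.
open Fin.CommRing in
theorem map_pow_char (hT : IsSpherical T) (hn : IsUnit (Fintype.card G : E)) (q : ℕ)
    [hq : Fact q.Prime] [CharP E q] (x : G) : T x ^ q = T (x ^ q) := by
  classical
  have h1 := hT.card_pow_mul_pow x q 1
  have hnq : (Fintype.card G : E) ^ q = Fintype.card G := by
    have := congrArg (ZMod.castHom dvd_rfl E) (ZMod.pow_card (Fintype.card G : ZMod q))
    rwa [map_pow, map_natCast] at this
  obtain ⟨p, rfl⟩ : ∃ p, q = p + 1 := ⟨q - 1, (Nat.succ_pred_eq_of_pos hq.out.pos).symm⟩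
  rw [hnq, hT.map_one, one_mul] at h1
  have hr : (fun (f : Fin (p + 1) → G) i => f (i + 1))^[p + 1] = id := by
    have : ∀ k : ℕ, (fun (f : Fin (p + 1) → G) i => f (i + 1))^[k] =
        fun f i => f (i + (k : Fin (p + 1))) := by
      intro k
      induction k with
      | zero => funext f i; simp
      | succ k ih =>
        funext f i
        rw [Function.iterate_succ_apply, ih]
        simp [add_assoc]
    rw [this]
    funext f i
    simp
  have hconst : ∀ f : Fin (p + 1) → G, (fun i => f (i + 1)) = f ↔ f = fun _ => f 0 := by
    intro f
    constructor
    · intro h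
      funext i
      induction i using Fin.induction with
      | zero => rfl
      | succ i ih => rw [← Fin.coeSucc_eq_succ, ← ih]; exact congrFun h i.castSucc
    · intro h
      rw [h]
  rw [sum_eq_sum_fixedPoints (p + 1) (fun (f : Fin (p + 1) → G) i => f (i + 1)) hr] at h1
  · apply hn.mul_left_cancel
    rw [h1, ← nsmul_eq_mul, ← Finset.card_univ, ← Finset.sum_const]
    symm
    refine Finset.sum_bij (fun h _ _ => h) ?_ ?_ ?_ ?_
    · intro h _
      simp
    · intro h _ h' _ e
      exact congrFun e 0
    · intro f hf
      exact ⟨f 0, Finset.mem_univ _, ((hconst f).1 (Finset.mem_filter.1 hf).2).symm⟩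
    · intro h _
      rw [List.ofFn_const, List.prod_replicate, one_mul, conj_pow, hT.map_conj hn]
  · intro f
    rw [one_mul, one_mul, List.ofFn_succ', List.ofFn_succ]
    simp only [Fin.coeSucc_eq_succ, Fin.last_add_one, List.concat_eq_append, List.prod_append,
      List.prod_cons, List.prod_nil, mul_one]
    rw [← hT.map_conj hn (f 0 * x * (f 0)⁻¹)]
    simp [mul_assoc]

end IsSpherical

end Spherical

/-! ### The table of spherical functions over an algebraically closed field -/

section SphericalTable

variable {G : Type*} [Group G] [Fintype G]

section Table

variable {K : Type*} [Field K] {q : ℕ}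

/-- Right convolution by the normalized sum over the conjugacy class of `y`. -/
noncomputable def conjTranslate (K : Type*) [Field K] (y : G) : Module.End K (G → K) where
  toFun f x := (Fintype.card G : K)⁻¹ * ∑ h, f (x * (h * y * h⁻¹))
  map_add' f g := by
    funext x
    simp [Finset.sum_add_distrib, mul_add]
  map_smul' c f := by
    funext x
    simp only [Pi.smul_apply, smul_eq_mul, ← Finset.mul_sum, RingHom.id_apply]
    ring

theorem conjTranslate_apply (y : G) (f : G → K) (x : G) :
    conjTranslate K y f x = (Fintype.card G : K)⁻¹ * ∑ h, f (x * (h * y * h⁻¹)) := rfl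

/-- An operator-valued spherical function: the general commutation and Frobenius results apply to
it, and its joint eigenvalues will be the scalar spherical functions. -/
theorem isSpherical_conjTranslate (hn : (Fintype.card G : K) ≠ 0) :
    IsSpherical (conjTranslate K : G → Module.End K (G → K)) where
  map_one := by
    refine LinearMap.ext fun f => funext fun x => ?_
    simp [conjTranslate_apply, inv_mul_cancel_left₀ hn]
  card_mul_mul a b := by
    refine LinearMap.ext fun f => funext fun x => ?_
    have h1 : ((Fintype.card G : Module.End K (G → K)) * (conjTranslate K a * conjTranslate K b)) f x
        = (Fintype.card G : K) * conjTranslate K a (conjTranslate K b f) x := by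
      rw [← nsmul_eq_mul, LinearMap.smul_apply, Pi.smul_apply, nsmul_eq_mul, Module.End.mul_apply]
    rw [h1, conjTranslate_apply, mul_inv_cancel_left₀ hn, LinearMap.sum_apply, Finset.sum_apply]
    simp only [conjTranslate_apply, ← Finset.mul_sum]
    congr 1
    conv_rhs => rw [Finset.sum_comm]
    refine Finset.sum_congr rfl fun k _ => ?_
    refine Fintype.sum_equiv (Equiv.mulLeft k⁻¹) _ _ fun h => ?_
    simp [mul_assoc]

/-- Averaging over conjugation. -/
noncomputable def conjAverage (G K : Type*) [Group G] [Fintype G] [Field K] :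
    (G → K) →ₗ[K] (G → K) where
  toFun f x := (Fintype.card G : K)⁻¹ * ∑ h, f (h * x * h⁻¹)
  map_add' f g := by
    funext x
    simp [Finset.sum_add_distrib, mul_add]
  map_smul' c f := by
    funext x
    simp only [Pi.smul_apply, smul_eq_mul, ← Finset.mul_sum, RingHom.id_apply]
    ring

theorem conjAverage_apply (f : G → K) (x : G) :
    conjAverage G K f x = (Fintype.card G : K)⁻¹ * ∑ h, f (h * x * h⁻¹) := rfl

theorem conjAverage_conj (f : G → K) (k x : G) :
    conjAverage G K f (k * x * k⁻¹) = conjAverage G K f x := by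
  rw [conjAverage_apply, conjAverage_apply]
  congr 1
  refine Fintype.sum_equiv (Equiv.mulRight k) _ _ fun h => ?_
  simp [mul_assoc]

theorem conjTranslate_conjAverage (y : G) (f : G → K) :
    conjTranslate K y (conjAverage G K f) = conjAverage G K (conjTranslate K y f) := by
  funext x
  simp only [conjTranslate_apply, conjAverage_apply, ← Finset.mul_sum]
  congr 2
  rw [Finset.sum_comm]
  refine Finset.sum_congr rfl fun k _ => ?_
  refine Fintype.sum_equiv (Equiv.mulLeft k) _ _ fun h => ?_
  simp [mul_assoc]

/-- This takes the place of Maschke's theorem. As q is prime to |G|, some q ^ N with N > 0 satisfies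
y ^ (q ^ N) = y. The operator is then a root of the separable polynomial X ^ (q ^ N) - X. -/
theorem conjTranslate_semisimple [CharP K q] [hq : Fact q.Prime] (hn : (Fintype.card G : K) ≠ 0)
    (y : G) : (conjTranslate K y).IsSemisimple := by
  have hs := isSpherical_conjTranslate (G := G) hn
  have : CharP (Module.End K (G → K)) q :=
    charP_of_injective_algebraMap (algebraMap K (Module.End K (G → K))).injective q
  have hu : IsUnit (Fintype.card G : Module.End K (G → K)) := by
    have := (isUnit_iff_ne_zero.2 hn).map (algebraMap K (Module.End K (G → K)))
    rwa [map_natCast] at this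
  have hpow : ∀ N x, conjTranslate K (x : G) ^ q ^ N = conjTranslate K (x ^ q ^ N) := by
    intro N x
    induction N with
    | zero => simp
    | succ N ih => rw [pow_succ, pow_mul, ih, hs.map_pow_char hu q, ← pow_mul]
  have hcop : q.Coprime (Fintype.card G) := by
    rw [hq.out.coprime_iff_not_dvd]
    intro h
    exact hn ((CharP.cast_eq_zero_iff K q _).2 h)
  let N := (Fintype.card G).totient
  have hN : N ≠ 0 := (Nat.totient_pos.2 Fintype.card_pos).ne'
  have hy : y ^ q ^ N = y := by
    have h1 := Nat.ModEq.pow_totient hcop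
    have h2 : q ^ N ≡ 1 [MOD orderOf y] := h1.of_dvd (orderOf_dvd_card)
    simpa using (pow_eq_pow_iff_modEq (x := y)).2 h2
  refine Module.End.isSemisimple_of_squarefree_aeval_eq_zero
    (galois_poly_separable q (q ^ N) (dvd_pow_self q hN)).squarefree ?_
  simp [hpow, hy]

theorem iSup_iInf_eigenspace_conjTranslate [IsAlgClosed K] [CharP K q] [hq : Fact q.Prime]
    (hn : (Fintype.card G : K) ≠ 0) :
    ⨆ χ : G → K, ⨅ y, (conjTranslate K y).eigenspace (χ y) = ⊤ := by
  have hs := isSpherical_conjTranslate (G := G) hn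
  have hu : IsUnit (Fintype.card G : Module.End K (G → K)) := by
    have := (isUnit_iff_ne_zero.2 hn).map (algebraMap K (Module.End K (G → K)))
    rwa [map_natCast] at this
  rw [← Module.End.iSup_iInf_maxGenEigenspace_eq_top_of_iSup_maxGenEigenspace_eq_top_of_commute
    (conjTranslate K : G → Module.End K (G → K)) (fun a b _ => hs.commute hu a b)
    (fun y => Module.End.iSup_maxGenEigenspace_eq_top _)]
  congr 1
  funext χ
  congr 1
  funext y
  rw [((conjTranslate_semisimple hn y).isFinitelySemisimple).maxGenEigenspace_eq_eigenspace]

/-- The spherical functions with values in `K`, viewed as functions on the conjugacy classes. -/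
def sphericalFunctions (G K : Type*) [Group G] [Fintype G] [Field K] : Set (ConjClasses G → K) :=
  {φ | IsSpherical fun g => φ (ConjClasses.mk g)}

/-- Joint eigenvectors span all functions, and averaging them over conjugation gives class functions
`w` with the same eigenvalues `χ`. Evaluating at 1 gives w(y) = χ(y) w(1), so either `w` is 0 or it
is a multiple of `χ`, which is then spherical. -/
theorem span_sphericalFunctions [IsAlgClosed K] [CharP K q] [hq : Fact q.Prime]
    (hn : (Fintype.card G : K) ≠ 0) : Submodule.span K (sphericalFunctions G K) = ⊤ := by
  let L : (ConjClasses G → K) →ₗ[K] (G → K) := LinearMap.funLeft K K ConjClasses.mk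
  have hL : Function.Injective L :=
    LinearMap.funLeft_injective_of_surjective K K _ ConjClasses.mk_surjective
  have key : ∀ v : G → K,
      conjAverage G K v ∈ (Submodule.span K (sphericalFunctions G K)).map L := by
    suffices h : ⊤ ≤ ((Submodule.span K (sphericalFunctions G K)).map L).comap (conjAverage G K) from
      fun v => h trivial
    rw [← iSup_iInf_eigenspace_conjTranslate (G := G) hn]
    refine iSup_le fun χ v hv => ?_
    rw [Submodule.mem_comap]
    simp only [Submodule.mem_iInf, Module.End.mem_eigenspace_iff] at hv
    set w := conjAverage G K v with hw
    have hwT : ∀ y, conjTranslate K y w = χ y • w := fun y => by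
      rw [hw, conjTranslate_conjAverage, hv, map_smul]
    have hwc : ∀ k x, w (k * x * k⁻¹) = w x := conjAverage_conj v
    have hw1 : ∀ y, w y = χ y * w 1 := fun y => by
      have := congrFun (hwT y) 1
      simpa [conjTranslate_apply, hwc, inv_mul_cancel_left₀ hn] using this
    by_cases h1 : w 1 = 0
    · have : w = 0 := by
        funext y
        rw [hw1, h1, mul_zero]; rfl
      rw [this]
      exact Submodule.zero_mem _
    · have hχ : ∀ y, χ y = w y * (w 1)⁻¹ := fun y => by
        rw [hw1 y, mul_inv_cancel_right₀ h1]
      have hχc : ∀ a b, IsConj a b → χ a = χ b := by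
        intro a b hab
        obtain ⟨c, rfl⟩ := isConj_iff.1 hab
        rw [hχ, hχ, hwc]
      let φ : ConjClasses G → K := Quotient.lift χ hχc
      have hφ : φ ∈ sphericalFunctions G K := by
        constructor
        · change χ 1 = 1
          rw [hχ, mul_inv_cancel₀ h1]
        · intro a b
          change _ * (χ a * χ b) = ∑ h, χ (a * (h * b * h⁻¹))
          have := congrFun (hwT b) a
          rw [conjTranslate_apply, Pi.smul_apply, smul_eq_mul, inv_mul_eq_iff_eq_mul₀ hn] at this
          simp only [hχ a, hχ (a * _), ← Finset.sum_mul]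
          rw [this]
          ring
      have : w = L (w 1 • φ) := by
        funext y
        change w y = w 1 * χ y
        rw [hw1 y, mul_comm]
      rw [this]
      exact Submodule.mem_map_of_mem (Submodule.smul_mem _ _ (Submodule.subset_span hφ))
  rw [eq_top_iff]
  intro φ _
  obtain ⟨ψ, hψ, h⟩ := key (L φ)
  have : conjAverage G K (L φ) = L φ := by
    funext x
    have : ∀ h : G, ConjClasses.mk (h * x * h⁻¹) = ConjClasses.mk x := fun h =>
      (ConjClasses.mk_eq_mk_iff_isConj.2 (isConj_iff.2 ⟨h, rfl⟩)).symm
    simp [conjAverage_apply, L, LinearMap.funLeft_apply, this, inv_mul_cancel_left₀ hn]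
  rw [this] at h
  rwa [← hL h]

/-- Let B be the pairing. Both θ(x) B and θ'(x) B equal ∑ θ(x g) θ'(g⁻¹), so B vanishes as soon as
some x separates θ from θ'. -/
theorem IsSpherical.sum_mul_inv_eq_zero {θ θ' : G → K} (hn : (Fintype.card G : K) ≠ 0)
    (hθ : IsSpherical θ) (hθ' : IsSpherical θ') (hne : θ ≠ θ') : ∑ g, θ g * θ' g⁻¹ = 0 := by
  have hu : IsUnit (Fintype.card G : K) := isUnit_iff_ne_zero.2 hn
  obtain ⟨x, hx⟩ := Function.ne_iff.1 hne
  have h1 : (Fintype.card G : K) * (θ x * ∑ g, θ g * θ' g⁻¹) =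
      Fintype.card G * ∑ g, θ (x * g) * θ' g⁻¹ := by
    calc (Fintype.card G : K) * (θ x * ∑ g, θ g * θ' g⁻¹)
        = ∑ g, (Fintype.card G : K) * (θ x * θ g) * θ' g⁻¹ := by
          rw [Finset.mul_sum, Finset.mul_sum]
          exact Finset.sum_congr rfl fun g _ => by ring
      _ = ∑ h : G, ∑ g, θ (x * (h * g * h⁻¹)) * θ' g⁻¹ := by
          rw [Finset.sum_comm]
          exact Finset.sum_congr rfl fun g _ => by rw [hθ.card_mul_mul, Finset.sum_mul]
      _ = ∑ h : G, ∑ g, θ (x * g) * θ' g⁻¹ := by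
          refine Finset.sum_congr rfl fun h _ => ?_
          refine Fintype.sum_equiv (MulAut.conj h).toEquiv _ _ fun g => ?_
          change _ = θ (x * (h * g * h⁻¹)) * θ' (h * g * h⁻¹)⁻¹
          rw [← hθ'.map_conj hu h g⁻¹]
          simp [mul_assoc]
      _ = _ := by simp
  have h2 : (Fintype.card G : K) * (θ' x * ∑ g, θ g * θ' g⁻¹) =
      Fintype.card G * ∑ g, θ g * θ' (x * g⁻¹) := by
    calc (Fintype.card G : K) * (θ' x * ∑ g, θ g * θ' g⁻¹)
        = ∑ g, θ g * ((Fintype.card G : K) * (θ' x * θ' g⁻¹)) := by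
          rw [Finset.mul_sum, Finset.mul_sum]
          exact Finset.sum_congr rfl fun g _ => by ring
      _ = ∑ h : G, ∑ g, θ g * θ' (x * (h * g⁻¹ * h⁻¹)) := by
          rw [Finset.sum_comm]
          exact Finset.sum_congr rfl fun g _ => by rw [hθ'.card_mul_mul, Finset.mul_sum]
      _ = ∑ h : G, ∑ g, θ g * θ' (x * g⁻¹) := by
          refine Finset.sum_congr rfl fun h _ => ?_
          refine Fintype.sum_equiv (MulAut.conj h).toEquiv _ _ fun g => ?_
          change _ = θ (h * g * h⁻¹) * θ' (x * (h * g * h⁻¹)⁻¹)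
          rw [hθ.map_conj hu]
          simp [mul_assoc]
      _ = _ := by simp
  have h3 : ∑ g, θ (x * g) * θ' g⁻¹ = ∑ g, θ g * θ' (x * g⁻¹) := by
    refine Fintype.sum_equiv (Equiv.mulLeft x) _ _ fun g => ?_
    rw [Equiv.coe_mulLeft, mul_inv_rev, ← hθ'.map_conj hu x g⁻¹, mul_assoc]
  rw [h3, ← h2] at h1
  have h4 := mul_left_cancel₀ hn h1
  rw [← sub_eq_zero, ← sub_mul] at h4
  exact (mul_eq_zero.1 h4).resolve_left (sub_ne_zero.2 hx)

/-- Otherwise θ would be orthogonal to the whole spanning set, hence to the indicator of {1}; but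
that pairing is θ(1) = 1. -/
theorem sum_mul_inv_ne_zero [IsAlgClosed K] [CharP K q] [hq : Fact q.Prime]
    (hn : (Fintype.card G : K) ≠ 0) {θ : G → K} (hθ : IsSpherical θ) :
    ∑ g, θ g * θ g⁻¹ ≠ 0 := by
  classical
  intro h0
  have hB : ∀ φ : ConjClasses G → K, ∑ g, θ g * φ (ConjClasses.mk g⁻¹) = 0 := by
    intro φ
    have hφ : φ ∈ Submodule.span K (sphericalFunctions G K) := by
      rw [span_sphericalFunctions hn]; trivial
    induction hφ using Submodule.span_induction with
    | mem φ hφ =>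
      by_cases h : θ = fun g => φ (ConjClasses.mk g)
      · rw [← h0]
        exact Finset.sum_congr rfl fun g _ => by rw [congrFun h g⁻¹]
      · exact hθ.sum_mul_inv_eq_zero hn hφ h
    | zero => simp
    | add φ ψ _ _ h1 h2 => simp [mul_add, Finset.sum_add_distrib, h1, h2]
    | smul c φ _ h =>
      have : ∀ g, θ g * (c • φ) (ConjClasses.mk g⁻¹) = c * (θ g * φ (ConjClasses.mk g⁻¹)) :=
        fun g => by simp; ring
      rw [Finset.sum_congr rfl fun g _ => this g, ← Finset.mul_sum, h, mul_zero]
  have h1 := hB fun c => if c = 1 then 1 else 0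
  rw [Finset.sum_eq_single 1] at h1
  · simp [ConjClasses.one_eq_mk_one, hθ.map_one] at h1
  · intro g _ hg
    rw [if_neg, mul_zero]
    rw [ConjClasses.one_eq_mk_one, ConjClasses.mk_eq_mk_iff_isConj, isConj_one_left]
    simpa using hg
  · simp

theorem linearIndependent_sphericalFunctions [IsAlgClosed K] [CharP K q] [hq : Fact q.Prime]
    (hn : (Fintype.card G : K) ≠ 0) :
    LinearIndependent K (Subtype.val : sphericalFunctions G K → ConjClasses G → K) := by
  rw [linearIndependent_iff']
  intro s c hc i hi
  have h1 : ∑ g : G, (∑ j ∈ s, c j • j.1) (ConjClasses.mk g) * i.1 (ConjClasses.mk g⁻¹) = 0 := by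
    rw [hc]
    simp
  simp only [Finset.sum_apply, Finset.sum_mul] at h1
  rw [Finset.sum_comm, Finset.sum_eq_single i] at h1
  · simp only [Pi.smul_apply, smul_eq_mul, mul_assoc, ← Finset.mul_sum] at h1
    exact (mul_eq_zero.1 h1).resolve_right (sum_mul_inv_ne_zero (q := q) hn i.2)
  · intro j _ hj
    simp only [Pi.smul_apply, smul_eq_mul, mul_assoc, ← Finset.mul_sum]
    rw [j.2.sum_mul_inv_eq_zero hn i.2, mul_zero]
    intro h
    apply hj
    apply Subtype.ext
    funext d
    obtain ⟨g, rfl⟩ := ConjClasses.mk_surjective d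
    exact congrFun h g
  · exact fun h => absurd hi h

/-- There are as many spherical functions as conjugacy classes. -/
theorem nonempty_equiv_sphericalFunctions [IsAlgClosed K] [CharP K q] [hq : Fact q.Prime]
    (hn : (Fintype.card G : K) ≠ 0) : Nonempty (ConjClasses G ≃ sphericalFunctions G K) := by
  classical
  have := Fintype.ofFinite (ConjClasses G)
  let b : Module.Basis (sphericalFunctions G K) K (ConjClasses G → K) :=
    Module.Basis.mk (linearIndependent_sphericalFunctions (q := q) hn) (by
      rw [Subtype.range_coe, span_sphericalFunctions hn])
  exact ⟨(Pi.basisFun K (ConjClasses G)).indexEquiv b⟩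

end Table

end SphericalTable

/-! ### Odd order: the determinant of the table -/

section OddOrder

variable {G : Type*} [Group G] [Fintype G]

theorem IsSpherical.comp_inv {E : Type*} [Ring E] {T : G → E} (hT : IsSpherical T)
    (hn : IsUnit (Fintype.card G : E)) : IsSpherical fun g => T g⁻¹ where
  map_one := by rw [inv_one, hT.map_one]
  card_mul_mul a b := by
    rw [hT.card_mul_mul]
    refine Finset.sum_congr rfl fun h _ => ?_
    rw [← hT.map_conj hn a⁻¹ (a * (h * b * h⁻¹))⁻¹]
    simp [mul_assoc]

theorem IsSpherical.map {E F : Type*} [Ring E] [Ring F] {T : G → E} (hT : IsSpherical T)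
    (f : E →+* F) : IsSpherical fun g => f (T g) where
  map_one := by rw [hT.map_one, _root_.map_one]
  card_mul_mul a b := by
    rw [← map_sum, ← hT.card_mul_mul, map_mul, map_mul, map_natCast]

theorem isSpherical_one {E : Type*} [Ring E] : IsSpherical (1 : G → E) where
  map_one := rfl
  card_mul_mul a b := by simp

theorem ConjClasses.sum_comp_mk {R : Type*} [Semiring R] [Fintype (ConjClasses G)]
    (f : ConjClasses G → R) :
    ∑ g : G, f (ConjClasses.mk g) = ∑ c : ConjClasses G, (Nat.card c.carrier : R) * f c := by
  classical
  rw [← Finset.sum_fiberwise_of_maps_to (s := Finset.univ) (t := Finset.univ)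
    (g := fun g : G => ConjClasses.mk g) (fun x _ => Finset.mem_univ _)]
  refine Finset.sum_congr rfl fun c _ => ?_
  rw [Finset.sum_congr rfl (g := fun _ => f c) fun g hg => by rw [(Finset.mem_filter.1 hg).2],
    Finset.sum_const, nsmul_eq_mul]
  congr 2
  rw [Nat.card_eq_fintype_card, ← Set.toFinset_card]
  congr 1
  ext g
  simp [ConjClasses.mem_carrier_iff_mk_eq]

theorem ConjClasses.card_carrier_zpowMap_neg_one {G : Type*} [Group G] (c : ConjClasses G) :
    Nat.card (ConjClasses.zpowMap (-1) c).carrier = Nat.card c.carrier := by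
  have key : ∀ (c : ConjClasses G) (g : G), g ∈ c.carrier → g⁻¹ ∈ (zpowMap (-1) c).carrier := by
    intro c g hg
    rw [mem_carrier_iff_mk_eq] at hg ⊢
    rw [← hg, zpowMap_mk, zpow_neg_one]
  refine Nat.card_congr ⟨fun g => ⟨g.1⁻¹, ?_⟩, fun g => ⟨g.1⁻¹, key c _ g.2⟩, ?_, ?_⟩
  · have := key _ _ g.2
    rwa [zpowMap_neg_one_involutive] at this
  · intro g; simp
  · intro g; simp

theorem ConjClasses.card_carrier_one {G : Type*} [Group G] :
    Nat.card (1 : ConjClasses G).carrier = 1 := by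
  have : (1 : ConjClasses G).carrier = {1} := by
    ext a
    rw [mem_carrier_iff_mk_eq, one_eq_mk_one, mk_eq_mk_iff_isConj, isConj_one_left]
    rfl
  rw [this]
  simp

theorem isCoprime_neg_one_card {G : Type*} : IsCoprime (-1 : ℤ) (Nat.card G : ℤ) :=
  isCoprime_one_left.neg_left

/-- The determinant of the table, rescaled by elements of F_q, is a square root `y` of ± |G| with y
^ q = ± y, the second sign being the one sought. Euler's criterion concludes. -/
theorem sign_powPerm_eq_legendreSym [DecidableEq G] (hG : Odd (Nat.card G)) (q : ℕ)
    [hq : Fact q.Prime] (hq2 : q ≠ 2) (hqn : Nat.card G < q)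
    (hm : IsCoprime (q : ℤ) (Nat.card G : ℤ)) :
    (sign (powPerm G q hm) : ℤ) =
      legendreSym q ((sign (powPerm G (-1) isCoprime_neg_one_card) : ℤˣ) * Nat.card G) := by
  classical
  have := Fintype.ofFinite (ConjClasses G)
  rw [sign_powPerm_eq_sign_zpowPerm hG, sign_powPerm_eq_sign_zpowPerm hG]
  set P := ConjClasses.zpowPerm (q : ℤ) hm with hP
  set J := ConjClasses.zpowPerm (G := G) (-1) isCoprime_neg_one_card with hJdef
  have hJ : ∀ c, J c = ConjClasses.zpowMap (-1) c := fun c => rfl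
  have hJJ : ∀ c, J (J c) = c := fun c => ConjClasses.zpowMap_neg_one_involutive c
  have hJmk : ∀ g, J (ConjClasses.mk g) = ConjClasses.mk g⁻¹ := fun g => by
    rw [hJ, ConjClasses.zpowMap_mk, zpow_neg_one]
  have hJfix : ∀ c, J c = c ↔ c = 1 := ConjClasses.zpowMap_neg_one_eq_iff hG
  let K := AlgebraicClosure (ZMod q)
  have : CharP K q := charP_of_injective_algebraMap (algebraMap (ZMod q) K).injective q
  have hnat : ∀ a : ℕ, a < q → a ≠ 0 → (a : K) ≠ 0 := fun a ha h0 h =>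
    absurd (Nat.le_of_dvd (Nat.pos_of_ne_zero h0) ((CharP.cast_eq_zero_iff K q a).1 h)) ha.not_ge
  have hcard : Nat.card G = Fintype.card G := Nat.card_eq_fintype_card
  have hn : (Fintype.card G : K) ≠ 0 := hnat _ (hcard ▸ hqn) Fintype.card_ne_zero
  have hu : IsUnit (Fintype.card G : K) := isUnit_iff_ne_zero.2 hn
  obtain ⟨e⟩ := nonempty_equiv_sphericalFunctions (G := G) (K := K) (q := q) hn
  obtain ⟨θ, hθ, hinj, hsurj⟩ : ∃ θ : ConjClasses G → ConjClasses G → K,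
      (∀ i, IsSpherical fun g => θ i (ConjClasses.mk g)) ∧ Function.Injective θ ∧
      ∀ φ : ConjClasses G → K, (IsSpherical fun g => φ (ConjClasses.mk g)) → ∃ i, θ i = φ :=
    ⟨fun i => (e i).1, fun i => (e i).2, Subtype.val_injective.comp e.injective,
      fun φ hφ => ⟨e.symm ⟨φ, hφ⟩, by simp⟩⟩
  have hpow : ∀ i c, θ i c ^ q = θ i (P c) := by
    intro i c
    obtain ⟨g, rfl⟩ := ConjClasses.mk_surjective c
    rw [(hθ i).map_pow_char hu q, hP, ConjClasses.zpowPerm_apply, ConjClasses.zpowMap_mk,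
      zpow_natCast]
  -- `ι` (dual) and `σ'` (Frobenius) permute the rows of the table; `J` and `P` permute its columns.
  choose ι hι using fun i => hsurj (fun c => θ i (J c)) (by
    simpa only [hJmk] using (hθ i).comp_inv hu)
  choose σ' hσ' using fun i => hsurj (fun c => θ i c ^ q) ((hθ i).map (frobenius K q))
  obtain ⟨i₀, hi₀⟩ := hsurj 1 isSpherical_one
  have hιι : Function.Involutive ι := fun i => hinj <| by
    funext c; simp only [hι, hJJ]
  have hσinj : Function.Injective σ' := fun i j h => hinj <| by
    funext c
    have := congrFun (congrArg θ h) c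
    rw [hσ', hσ'] at this
    exact frobenius_inj K q this
  let σ : Perm (ConjClasses G) := Equiv.ofBijective σ' (Finite.injective_iff_bijective.1 hσinj)
  have hσ : ∀ i c, θ (σ i) c = θ i c ^ q := fun i c => congrFun (hσ' i) c
  have hσι : ∀ i, σ (ι i) = ι (σ i) := fun i => hinj <| by
    funext c; simp only [hσ, hι]
  -- For an ordinary character χ this would be |G| / χ(1) ^ 2.
  let s : ConjClasses G → K := fun i => ∑ g, θ i (ConjClasses.mk g) * θ i (ConjClasses.mk g⁻¹)
  have hs0 : ∀ i, s i ≠ 0 := fun i => sum_mul_inv_ne_zero (q := q) hn (hθ i)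
  have hsι : ∀ i, s (ι i) = s i := fun i => by
    simp only [s, hι, hJmk, inv_inv]
    exact Finset.sum_congr rfl fun g _ => mul_comm _ _
  have hsσ : ∀ i, s (σ i) = s i ^ q := fun i => by
    simp only [s, hσ]
    rw [sum_pow_char]
    exact Finset.sum_congr rfl fun g _ => (mul_pow _ _ _).symm
  have hsi₀ : s i₀ = Nat.card G := by
    simp [s, hi₀]
  let M : Matrix (ConjClasses G) (ConjClasses G) K := Matrix.of θ
  let z : ConjClasses G → ℕ := fun c => Nat.card c.carrier
  -- Row orthogonality in matrix form, summed over classes with the class sizes as weights.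
  have hMM : M * Matrix.diagonal (fun c => (z c : K)) * (M.submatrix id J).transpose =
      Matrix.diagonal s := by
    ext i j
    have : (M * Matrix.diagonal (fun c => (z c : K)) * (M.submatrix id J).transpose) i j =
        ∑ g, θ i (ConjClasses.mk g) * θ j (ConjClasses.mk g⁻¹) := by
      rw [Matrix.mul_apply]
      simp only [Matrix.mul_diagonal, Matrix.transpose_apply,
        Matrix.submatrix_apply, id, M, Matrix.of_apply, ← hJmk]
      rw [ConjClasses.sum_comp_mk (fun c => θ i c * θ j (J c))]
      exact Finset.sum_congr rfl fun c _ => by ring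
    rw [this]
    by_cases h : i = j
    · subst h; rw [Matrix.diagonal_apply_eq]
    · rw [Matrix.diagonal_apply_ne _ h]
      refine (hθ i).sum_mul_inv_eq_zero hn (hθ j) fun h' => h (hinj ?_)
      funext c
      obtain ⟨g, rfl⟩ := ConjClasses.mk_surjective c
      exact congrFun h' g
  have hdet1 : M.det * (∏ c, (z c : K)) * (((sign J : ℤˣ) : ℤ) * M.det) = ∏ i, s i := by
    have := congrArg Matrix.det hMM
    rwa [Matrix.det_mul, Matrix.det_mul, Matrix.det_diagonal, Matrix.det_diagonal,
      Matrix.det_transpose, Matrix.det_permute'] at this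
  have hdet0 : M.det ≠ 0 := by
    intro h
    rw [h, zero_mul, zero_mul] at hdet1
    exact Finset.prod_ne_zero_iff.2 (fun i _ => hs0 i) hdet1.symm
  -- Raising the entries to the power q permutes the columns by `P`.
  have hdet2 : M.det ^ q = ((sign P : ℤˣ) : ℤ) * M.det := by
    rw [← Matrix.det_permute', ← frobenius_def, RingHom.map_det]
    congr 1
    ext i c
    exact hpow i c
  -- Brauer's permutation lemma: `ι` on rows and `J` on columns have the same effect on the
  -- invertible matrix `M`, so comparing traces shows that they have equally many fixed points
  -- modulo q. Both counts are below q since q > |G|.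
  have hιfix : ∀ i, ι i = i ↔ i = i₀ := by
    have hMN : M * M⁻¹ = 1 := Matrix.mul_nonsing_inv _ (isUnit_iff_ne_zero.2 hdet0)
    have hNM : M⁻¹ * M = 1 := Matrix.nonsing_inv_mul _ (isUnit_iff_ne_zero.2 hdet0)
    have h1 : ((Finset.univ.filter fun i => ι i = i).card : K) = 1 := by
      have h2 : ∑ i, (M * M⁻¹) (ι i) i = ∑ c, (M⁻¹ * M) c (J c) := by
        simp only [Matrix.mul_apply]
        rw [Finset.sum_comm]
        refine Finset.sum_congr rfl fun c _ => Finset.sum_congr rfl fun i _ => ?_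
        rw [mul_comm]
        congr 1
        exact congrFun (hι i) c
      rw [hMN, hNM] at h2
      simp only [Matrix.one_apply, Finset.sum_boole] at h2
      rw [h2]
      have : (Finset.univ.filter fun c => c = J c) = {(1 : ConjClasses G)} := by
        ext c
        simp [eq_comm (a := c) (b := J c), hJfix]
      rw [this, Finset.card_singleton, Nat.cast_one]
    have h3 : (Finset.univ.filter fun i => ι i = i).card = 1 := by
      rw [← Nat.cast_one, CharP.natCast_eq_natCast K q] at h1
      refine Nat.ModEq.eq_of_lt_of_lt h1 (lt_of_le_of_lt ?_ hqn) hq.out.one_lt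
      rw [hcard]
      exact (Finset.card_le_univ _).trans
        (Fintype.card_le_of_surjective _ ConjClasses.mk_surjective)
    have h4 : ι i₀ = i₀ := hinj <| by
      funext c
      rw [hι, hi₀]; rfl
    obtain ⟨a, ha⟩ := Finset.card_eq_one.1 h3
    have h5 : ∀ i, ι i = i ↔ i = a := fun i => by
      simpa using Finset.ext_iff.1 ha i
    intro i
    rw [h5, (h5 i₀).1 h4]
  obtain ⟨S, hS⟩ := exists_half_system J hJJ 1 hJfix
  obtain ⟨S', hS'⟩ := exists_half_system ι hιι i₀ hιfix
  have hz := (hS z fun c => ConjClasses.card_carrier_zpowMap_neg_one c).1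
  have hz1 : z 1 = 1 := ConjClasses.card_carrier_one
  obtain ⟨hsprod, hsperm⟩ := hS' s hsι
  generalize hd : ∏ c ∈ S, z c = d at hz
  generalize hh : ∏ i ∈ S', s i = h at hsprod hsperm
  have hh0 : h ≠ 0 := by
    rw [← hh]; exact Finset.prod_ne_zero_iff.2 fun i _ => hs0 i
  -- Frobenius permutes the pairs {i, ι i}, so the half product `h` lies in F_q. This makes `h ^ 2`
  -- a square in F_q, which is not clear for a single `s i`.
  have hhq : h ^ q = h := by
    have := hsperm σ hσι
    rw [Finset.prod_congr rfl fun i _ => hsσ i, Finset.prod_pow, hh] at this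
    exact this
  have hdq : (d : K) ^ q = d := by
    have := congrArg (algebraMap (ZMod q) K) (ZMod.pow_card (d : ZMod q))
    rwa [map_pow, map_natCast] at this
  have hJ2 : (((sign J : ℤˣ) : ℤ) : K) * ((sign J : ℤˣ) : ℤ) = 1 := by
    rw [← Int.cast_mul, Int.units_coe_mul_self, Int.cast_one]
  rw [← Nat.cast_prod, hz, hz1, one_mul, hsprod, hsi₀, Nat.cast_pow] at hdet1
  let y : K := M.det * d / h
  have hy2 : y ^ 2 = (((sign J : ℤˣ) * Nat.card G : ℤ) : K) := by
    simp only [y]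
    rw [div_pow, div_eq_iff (pow_ne_zero _ hh0), Int.cast_mul, Int.cast_natCast, mul_assoc, ← hdet1]
    linear_combination (-(M.det * d) ^ 2) * hJ2
  have hy0 : y ≠ 0 := by
    intro h0
    rw [h0, zero_pow two_ne_zero, Int.cast_mul, Int.cast_natCast, hcard, eq_comm, mul_eq_zero] at hy2
    rcases hy2 with h | h
    · rw [h, zero_mul] at hJ2
      exact zero_ne_one hJ2
    · exact hn h
  have hyq : y ^ (q - 1) = ((sign P : ℤˣ) : ℤ) := by
    have : y ^ q = ((sign P : ℤˣ) : ℤ) * y := by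
      simp only [y]
      rw [div_pow, mul_pow, hdet2, hdq, hhq]
      ring
    apply mul_right_cancel₀ hy0
    rw [← this, ← pow_succ, Nat.sub_add_cancel hq.out.one_le]
  have hodd : 2 * (q / 2) = q - 1 := by
    have := hq.out.eq_two_or_odd
    omega
  have hleg : ((legendreSym q ((sign J : ℤˣ) * Nat.card G) : ℤ) : K) = ((sign P : ℤˣ) : ℤ) := by
    have := congrArg (algebraMap (ZMod q) K) (legendreSym.eq_pow q ((sign J : ℤˣ) * Nat.card G))
    rw [map_intCast, map_pow, map_intCast, ← hy2, ← pow_mul, hodd, hyq] at this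
    exact this
  -- Both sides lie in {-1, 0, 1}, so a congruence modulo q > 2 is an equality.
  have hq3 : (2 : ℤ) < q := by
    have := lt_of_le_of_ne hq.out.two_le (Ne.symm hq2)
    exact_mod_cast this
  rw [jacobiSym.legendreSym.to_jacobiSym] at hleg ⊢
  rw [← sub_eq_zero, ← Int.cast_sub, CharP.intCast_eq_zero_iff K q] at hleg
  refine (sub_eq_zero.1 (Int.eq_zero_of_abs_lt_dvd hleg (lt_of_le_of_lt ?_ hq3))).symm
  rcases jacobiSym.trichotomy ((sign J : ℤˣ) * Nat.card G) q with h | h | h <;>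
  rcases Int.units_eq_one_or (sign P) with h' | h' <;>
  rw [h, h'] <;> decide

end OddOrder

/-! ### Reciprocity for the Kronecker symbol, and the sign in odd order -/

section Reciprocity

theorem kroneckerSym_of_odd (d : ℤ) {m : ℤ} (hm : Odd m) :
    kroneckerSym d m = (if m < 0 then kroneckerNegOne d else 1) * jacobiSym d m.natAbs := by
  have h0 : m ≠ 0 := by rintro rfl; simp at hm
  have h1 : m.natAbs.factorization 2 = 0 := by
    apply Nat.factorization_eq_zero_of_not_dvd
    rw [← even_iff_two_dvd, Int.natAbs_even, Int.not_even_iff_odd]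
    exact hm
  rw [kroneckerSym, if_neg h0, h1, pow_zero, pow_zero, mul_one, Nat.div_one]

/-- The condition `c ≠ 0` matters when `m` = -1: coprimality then allows c = 0, and the factor at -1
would lose the sign of `d`. -/
theorem kroneckerSym_mul_sq (d c : ℤ) {m : ℤ} (hm : Odd m) (hc : IsCoprime c m) (hc0 : c ≠ 0) :
    kroneckerSym (d * c ^ 2) m = kroneckerSym d m := by
  rw [kroneckerSym_of_odd _ hm, kroneckerSym_of_odd _ hm, jacobiSym.mul_left, jacobiSym.pow_left,
    jacobiSym.sq_one, mul_one]
  · congr 1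
    have : d * c ^ 2 < 0 ↔ d < 0 := by
      have : 0 < c ^ 2 := by positivity
      constructor
      · intro h
        by_contra h'
        push Not at h'
        nlinarith
      · intro h
        nlinarith
    simp only [kroneckerNegOne, this]
  · rw [← Int.isCoprime_iff_gcd_eq_one, Int.natCast_natAbs]
    exact hc.abs_right

theorem kroneckerSym_one_of_odd {m : ℤ} (hm : Odd m) : kroneckerSym 1 m = 1 := by
  simp [kroneckerSym_of_odd _ hm, kroneckerNegOne, jacobiSym.one_left]

theorem kroneckerSym_neg_one_of_odd {m : ℤ} (hm : Odd m) :
    kroneckerSym (-1) m = if m % 4 = 1 then 1 else -1 := by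
  have h : Odd m.natAbs := Int.natAbs_odd.2 hm
  rw [kroneckerSym_of_odd _ hm, jacobiSym.at_neg_one h, ZMod.χ₄_nat_eq_if_mod_four]
  have := Int.odd_iff.1 hm
  simp only [kroneckerNegOne]
  split_ifs <;> omega

theorem neg_one_pow_half_mul_self {n : ℕ} (hn : Odd n) :
    (-1 : ℤ) ^ ((n - 1) / 2) * n = if n % 4 = 1 then (n : ℤ) else -n := by
  obtain ⟨k, rfl⟩ := hn
  rw [Nat.add_sub_cancel, Nat.mul_div_cancel_left _ two_pos]
  rcases Nat.even_or_odd k with h | h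
  · rw [h.neg_one_pow, if_pos, one_mul]
    have := Nat.even_iff.1 h
    omega
  · rw [h.neg_one_pow, if_neg, neg_one_mul]
    have := Nat.odd_iff.1 h
    omega

theorem jacobiSym_neg_one_pow_half_mul_self {n b : ℕ} (hn : Odd n) (hb : Odd b) :
    jacobiSym ((-1) ^ ((n - 1) / 2) * n) b = jacobiSym b n := by
  have h : (n - 1) / 2 = n / 2 := by
    obtain ⟨k, rfl⟩ := hn
    omega
  rw [h, jacobiSym.mul_left, jacobiSym.pow_left, jacobiSym.at_neg_one hb,
    ZMod.χ₄_eq_neg_one_pow (Nat.odd_iff.1 hb), ← pow_mul, jacobiSym.quadratic_reciprocity hn hb,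
    ← mul_assoc, mul_comm (b / 2), ← pow_add, ← two_mul, pow_mul, neg_one_sq, one_pow, one_mul]

/-- Quadratic reciprocity for the Kronecker symbol. -/
theorem kroneckerSym_neg_one_pow_half_mul_self {n : ℕ} (hn : Odd n) {m : ℤ}
    (hm : IsCoprime m (n : ℤ)) :
    kroneckerSym ((-1) ^ ((n - 1) / 2) * n) m = jacobiSym m n := by
  -- Coprimality with 0 forces n = 1, and both symbols are 1.
  by_cases h0 : m = 0
  · subst h0
    have : n = 1 := by
      rw [isCoprime_zero_left, Int.isUnit_iff_natAbs_eq] at hm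
      simpa using hm
    subst this
    simp [kroneckerSym]
  -- The integer (-1) ^ ((n - 1) / 2) * n is n or -n, whichever is 1 modulo 4. Its sign gives the
  -- supplementary law at -1, its residue modulo 8 the one at 2.
  have hsign : kroneckerNegOne ((-1) ^ ((n - 1) / 2) * n) = jacobiSym (-1) n := by
    rw [jacobiSym.at_neg_one hn, neg_one_pow_half_mul_self hn, ZMod.χ₄_nat_eq_if_mod_four,
      kroneckerNegOne]
    have := Nat.odd_iff.1 hn
    split_ifs <;> omega
  have htwo : kroneckerTwo ((-1) ^ ((n - 1) / 2) * n) = jacobiSym 2 n := by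
    rw [jacobiSym.at_two hn, neg_one_pow_half_mul_self hn, ZMod.χ₈_nat_eq_if_mod_eight,
      kroneckerTwo]
    have := Nat.odd_iff.1 hn
    split_ifs <;> omega
  have hodd : Odd (m.natAbs / 2 ^ m.natAbs.factorization 2) := by
    rw [← Nat.coprime_two_left]
    exact Nat.coprime_ordCompl Nat.prime_two (Int.natAbs_ne_zero.2 h0)
  have habs : jacobiSym (m.natAbs : ℤ) n = jacobiSym 2 n ^ m.natAbs.factorization 2 *
      jacobiSym ((m.natAbs / 2 ^ m.natAbs.factorization 2 : ℕ) : ℤ) n := by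
    conv_lhs => rw [← Nat.ordProj_mul_ordCompl_eq_self m.natAbs 2]
    rw [Nat.cast_mul, jacobiSym.mul_left, Nat.cast_pow, jacobiSym.pow_left]
    rfl
  rw [kroneckerSym, if_neg h0, hsign, htwo, jacobiSym_neg_one_pow_half_mul_self hn hodd, mul_assoc,
    ← habs]
  split_ifs with h
  · rw [← jacobiSym.mul_left]
    congr 1
    omega
  · rw [one_mul]
    congr 1
    omega

section Group

variable (G : Type*) [Group G]

theorem card_powEqOne_two_of_odd (hG : Odd (Nat.card G)) : Nat.card (powEqOne G 2) = 1 := by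
  have : powEqOne G 2 = {1} := by
    ext g
    exact pow_two_eq_one_iff_of_odd_card hG g
  rw [this]
  simp

variable [Fintype G] [DecidableEq G]

theorem powPerm_congr (G : Type*) [Group G] [Finite G] {m k : ℤ} (hm : IsCoprime m (Nat.card G : ℤ))
    (hk : IsCoprime k (Nat.card G : ℤ)) (h : m ≡ k [ZMOD Nat.card G]) :
    powPerm G m hm = powPerm G k hk := by
  ext g
  rw [powPerm_apply, powPerm_apply, zpow_eq_zpow_iff_modEq]
  exact h.of_dvd (Int.natCast_dvd_natCast.2 (orderOf_dvd_natCard g))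

theorem sign_powPerm_neg_one : sign (powPerm G (-1) isCoprime_neg_one_card) =
    (-1) ^ ((Nat.card G - Nat.card (powEqOne G 2)) / 2) := by
  have h : powPerm G (-1) isCoprime_neg_one_card ^ 2 = 1 := by
    ext g
    simp [pow_two]
  rw [sign_of_pow_two_eq_one h, ← Nat.card_eq_fintype_card, ← Nat.card_eq_fintype_card]
  have : Function.fixedPoints (powPerm G (-1) isCoprime_neg_one_card) = powEqOne G 2 := by
    ext g
    change g ^ (-1 : ℤ) = g ↔ g ^ 2 = 1
    rw [zpow_neg_one, pow_two, inv_eq_iff_mul_eq_one]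
  rw [this]

/-- The sign of `g ↦ g ^ m` on a group of odd order is the Jacobi symbol. -/
theorem sign_powPerm_of_odd (hG : Odd (Nat.card G)) (m : ℤ)
    (hm : IsCoprime m (Nat.card G : ℤ)) :
    ((sign (powPerm G m hm) : ℤˣ) : ℤ) = jacobiSym m (Nat.card G) := by
  -- Dirichlet: the power map depends only on `m` modulo |G|. The maximum with 2 makes q odd as well
  -- as larger than |G|.
  obtain ⟨q, hqn, hq, hqm⟩ := Nat.forall_exists_prime_gt_and_zmodEq (max (Nat.card G) 2)
    Nat.card_pos.ne' hm
  have : Fact q.Prime := ⟨hq⟩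
  have hq2 : 2 < q := (le_max_right _ _).trans_lt hqn
  have hqG : Nat.card G < q := (le_max_left _ _).trans_lt hqn
  have hqc : IsCoprime (q : ℤ) (Nat.card G : ℤ) := by
    rw [Nat.isCoprime_iff_coprime, hq.coprime_iff_not_dvd]
    exact fun h => absurd (Nat.le_of_dvd Nat.card_pos h) hqG.not_ge
  rw [powPerm_congr G hm hqc hqm.symm, sign_powPerm_eq_legendreSym hG q hq2.ne' hqG hqc,
    sign_powPerm_neg_one, card_powEqOne_two_of_odd G hG, jacobiSym.legendreSym.to_jacobiSym]
  push_cast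
  rw [jacobiSym_neg_one_pow_half_mul_self hG (hq.odd_of_ne_two hq2.ne')]
  exact jacobiSym.mod_left' hqm

theorem dGroup_of_odd (G : Type*) [Group G] (hG : Odd (Nat.card G)) :
    dGroup G = (-1) ^ ((Nat.card G - 1) / 2) * Nat.card G := by
  have h : ¬ Nat.card G = 2 * numSylowTwo G := by
    intro h
    rw [h] at hG
    exact Nat.not_even_iff_odd.2 hG (even_two_mul _)
  rw [dGroup, card_powEqOne_two_of_odd G hG, epsGroup, if_neg h, pow_zero, pow_one, Nat.div_one]

end Group

end Reciprocity

theorem sign_powPerm_eq_kroneckerSym_of_odd (G : Type*) [Group G] [Fintype G] [DecidableEq G]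
    (hG : Odd (Nat.card G)) (m : ℤ) (hm : IsCoprime m (Nat.card G : ℤ)) :
    ((sign (powPerm G m hm) : ℤˣ) : ℤ) = kroneckerSym (dGroup G) m := by
  rw [sign_powPerm_of_odd G hG, dGroup_of_odd G hG, kroneckerSym_neg_one_pow_half_mul_self hG hm]

/-! ### Groups of even order -/

theorem odd_of_isCoprime_of_even {m : ℤ} {n : ℕ} (hm : IsCoprime m (n : ℤ)) (hn : Even n) :
    Odd m := by
  rw [← Int.not_even_iff_odd, even_iff_two_dvd]
  intro h
  have h2 : (2 : ℤ) ∣ n := Int.natCast_dvd_natCast.2 hn.two_dvd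
  have := hm.isUnit_of_dvd' h h2
  rw [Int.isUnit_iff] at this
  omega

theorem zpow_eq_self_of_sq_eq_one {G : Type*} [Group G] {x : G} (hx : x ^ 2 = 1) {m : ℤ}
    (hm : Odd m) :
    x ^ m = x := by
  obtain ⟨k, rfl⟩ := hm
  rw [zpow_add, zpow_mul, zpow_one, show (2 : ℤ) = ((2 : ℕ) : ℤ) from rfl, zpow_natCast, hx,
    one_zpow, one_mul]

theorem powPerm_pow_apply {G : Type*} [Group G] [Finite G] (m : ℤ)
    (hm : IsCoprime m (Nat.card G : ℤ)) (i : ℕ) (x : G) : (powPerm G m hm ^ i) x = x ^ m ^ i := by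
  induction i with
  | zero => simp
  | succ i ih => rw [pow_succ', Perm.mul_apply, ih, powPerm_apply, ← zpow_mul, pow_succ]

/-- On a `2`-group, `g ↦ g ^ m` is even for `m ≡ 1 (mod 4)`. -/
theorem IsPGroup.sign_powPerm_eq_one {H : Type*} [Group H] [Fintype H] [DecidableEq H]
    (hH : IsPGroup 2 H) (m : ℤ) (hm : IsCoprime m (Nat.card H : ℤ)) (h4 : m % 4 = 1) :
    sign (powPerm H m hm) = 1 := by
  classical
  set ψ := powPerm H m hm with hψ
  have hodd : Odd m := Int.odd_iff.2 (by omega)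
  have hinv : ∀ x : H, x⁻¹ = x ↔ x ^ 2 = 1 := fun x => by rw [pow_two, inv_eq_iff_mul_eq_one]
  -- If x ^ (m ^ i) = x⁻¹, the order of x divides m ^ i + 1, which is 2 modulo 4. Being a power of
  -- 2, the order is at most 2.
  have hcyc : ∀ x : H, x⁻¹ ≠ x → ¬ ψ.SameCycle x x⁻¹ := by
    intro x hx h
    obtain ⟨i, -, hi⟩ := h.exists_pow_eq'
    rw [powPerm_pow_apply] at hi
    have h1 : x ^ (m ^ i + 1) = 1 := by rw [zpow_add, hi, zpow_one, inv_mul_cancel]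
    have h2 := orderOf_dvd_iff_zpow_eq_one.2 h1
    obtain ⟨k, hk⟩ := IsPGroup.iff_orderOf.1 hH x
    have h3 : m ^ i % 4 = 1 := by
      have : m ^ i ≡ 1 ^ i [ZMOD 4] := Int.ModEq.pow i h4
      rwa [one_pow] at this
    have hk1 : k ≤ 1 := by
      by_contra h
      have h4 : (4 : ℤ) ∣ (orderOf x : ℤ) := by
        rw [hk]
        exact_mod_cast pow_dvd_pow 2 (show 2 ≤ k by omega)
      have := h4.trans h2
      omega
    apply hx
    rw [hinv, ← orderOf_dvd_iff_pow_eq_one, hk]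
    simpa using pow_dvd_pow 2 hk1
  let Q := Quotient (SameCycle.setoid ψ)
  let o : LinearOrder Q := LinearOrder.lift' (Fintype.equivFin Q) (Fintype.equivFin Q).injective
  let c : H → Q := fun x => Quotient.mk _ x
  have hc : ∀ x, x⁻¹ ≠ x → c x ≠ c x⁻¹ := fun x hx h => hcyc x hx (Quotient.exact h)
  have hcψ : ∀ x, c (ψ x) = c x := fun x =>
    Quotient.sound (show ψ.SameCycle (ψ x) x from sameCycle_apply_left.2 (SameCycle.refl _ _))
  have hψinv : ∀ x, ψ x⁻¹ = (ψ x)⁻¹ := fun x => by simp [hψ]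
  -- Comparing cycles instead of elements makes `ε` constant along the cycles of `ψ`, so every
  -- factor in Gauss's lemma is 1.
  let ε : H → ℤˣ := fun x => if c x < c x⁻¹ then 1 else -1
  rw [sign_eq_prod_half_system (fun x : H => x⁻¹) inv_inv ψ hψinv
    (fun x hx => zpow_eq_self_of_sq_eq_one ((hinv x).1 hx) hodd) ε]
  · refine Finset.prod_eq_one fun x hx => ?_
    rw [← (Finset.mem_filter.1 hx).2.2]
    simp only [ε, ← hψinv, hcψ]
  · intro x hx
    simp only [ε, inv_inv]
    rcases lt_or_gt_of_ne (hc x hx) with h | h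
    · rw [if_pos h, if_neg h.not_gt]
    · rw [if_pos h, if_neg h.not_gt, neg_neg]

theorem sign_powPerm_prod {K H : Type*} [Group K] [Group H] [Fintype K] [Fintype H]
    [DecidableEq K] [DecidableEq H] (m : ℤ) (hm : IsCoprime m (Nat.card (K × H) : ℤ))
    (hK : IsCoprime m (Nat.card K : ℤ)) (hH : IsCoprime m (Nat.card H : ℤ)) :
    sign (powPerm (K × H) m hm) =
      sign (powPerm K m hK) ^ Nat.card H * sign (powPerm H m hH) ^ Nat.card K := by
  have : powPerm (K × H) m hm = prodCongrLeft (fun _ : H => powPerm K m hK) *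
      prodCongrRight (fun _ : K => powPerm H m hH) := by
    ext x <;> rfl
  rw [this, Perm.sign_mul, sign_prodCongrLeft, sign_prodCongrRight, Finset.prod_const,
    Finset.prod_const, Finset.card_univ, Finset.card_univ, Nat.card_eq_fintype_card,
    Nat.card_eq_fintype_card]

theorem sign_powPerm_congr {G G' : Type*} [Group G] [Group G'] [Fintype G] [Fintype G']
    [DecidableEq G] [DecidableEq G'] (e : G ≃* G') (m : ℤ) (hm : IsCoprime m (Nat.card G : ℤ))
    (hm' : IsCoprime m (Nat.card G' : ℤ)) :
    sign (powPerm G m hm) = sign (powPerm G' m hm') :=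
  sign_eq_sign_of_equiv _ _ e.toEquiv fun x => by simp

theorem card_powEqOne_two_even {G : Type*} [Group G] [Finite G] (hG : Even (Nat.card G)) :
    Even (Nat.card (powEqOne G 2)) := by
  have h1 := card_sub_card_powEqOne_even G
  have h2 : Nat.card (powEqOne G 2) ≤ Nat.card G :=
    Nat.card_le_card_of_injective _ Subtype.val_injective
  rw [Nat.even_iff] at hG ⊢
  omega

theorem sign_powPerm_eq_kroneckerSym_of_prod {G K H : Type*} [Group G] [Group K] [Group H]
    [Fintype G] [DecidableEq G]
    (hK : Odd (Nat.card K)) (hH : IsPGroup 2 H) (e : G ≃* K × H) (m : ℤ)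
    (hm : IsCoprime m (Nat.card G : ℤ)) :
    ((sign (powPerm G m hm) : ℤˣ) : ℤ) = kroneckerSym (dGroup G) m := by
  classical
  rcases Nat.even_or_odd (Nat.card G) with hG | hG
  swap
  · exact sign_powPerm_eq_kroneckerSym_of_odd G hG m hm
  have hfin : Finite (K × H) := Finite.of_equiv G e.toEquiv
  have : Finite K := Finite.of_surjective (Prod.fst : K × H → K) Prod.fst_surjective
  have : Finite H := Finite.of_surjective (Prod.snd : K × H → H) Prod.snd_surjective
  have := Fintype.ofFinite K
  have := Fintype.ofFinite H
  have hcard : Nat.card G = Nat.card K * Nat.card H := by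
    rw [Nat.card_congr e.toEquiv, Nat.card_prod]
  have hHeven : Even (Nat.card H) := by
    rw [hcard, Nat.even_mul] at hG
    exact hG.resolve_left (Nat.not_even_iff_odd.2 hK)
  have hodd : Odd m := odd_of_isCoprime_of_even hm hG
  -- The contribution of K is raised to the even power |H|, and that of H is trivial for k ≡ 1 (mod
  -- 4).
  have hone : ∀ (k : ℤ) (hk : IsCoprime k (Nat.card G : ℤ)), k % 4 = 1 →
      sign (powPerm G k hk) = 1 := by
    intro k hk h4
    have hk' := hk
    rw [hcard, Nat.cast_mul] at hk'
    rw [sign_powPerm_congr e k hk (by rwa [Nat.card_prod, Nat.cast_mul]),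
      sign_powPerm_prod k _ hk'.of_mul_right_left hk'.of_mul_right_right,
      hH.sign_powPerm_eq_one k _ h4, one_pow, mul_one]
    have : ∀ u : ℤˣ, u ^ Nat.card H = 1 := fun u => by
      obtain ⟨r, hr⟩ := hHeven
      rw [hr, pow_add, Int.units_mul_self]
    exact this _
  -- The kernel of the projection to K is a normal Sylow 2-subgroup, so the denominator of d_G is 1
  -- whatever ε(G) is.
  have hsyl : numSylowTwo G = 1 := by
    let f : G →* K := (MonoidHom.fst K H).comp e.toMonoidHom
    have hf : Function.Surjective f := fun x => ⟨e.symm (x, 1), by simp [f]⟩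
    have hp : IsPGroup 2 f.ker := by
      intro g
      obtain ⟨k, hk⟩ := hH (e g.1).2
      refine ⟨k, Subtype.ext (e.injective ?_)⟩
      have h1 : (e g.1).1 = 1 := g.2
      rw [Subgroup.coe_pow, map_pow, Subgroup.coe_one, map_one]
      exact Prod.ext (by simp [h1]) (by simpa using hk)
    have hi : ¬ 2 ∣ f.ker.index := by
      rw [Subgroup.index_ker, MonoidHom.range_eq_top.2 hf, Subgroup.card_top]
      exact fun h => Nat.not_even_iff_odd.2 hK (even_iff_two_dvd.2 h)
    have : ((hp.toSylow hi : Sylow 2 G) : Subgroup G).Normal := by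
      rw [IsPGroup.toSylow_coe]; infer_instance
    have := Sylow.unique_of_normal (hp.toSylow hi) this
    rw [numSylowTwo, Nat.card_unique]
  obtain ⟨r, hr⟩ := card_powEqOne_two_even hG
  have hd : dGroup G = (-1) ^ ((Nat.card G - Nat.card (powEqOne G 2)) / 2) *
      ((Nat.card G : ℤ) ^ r) ^ 2 := by
    rw [dGroup, hsyl, one_pow, Nat.div_one]
    congr 1
    rw [hr, ← two_mul, mul_comm 2, pow_mul]
    push_cast
    rfl
  rw [hd, kroneckerSym_mul_sq _ _ hodd hm.symm.pow_left
    (pow_ne_zero _ (Nat.cast_ne_zero.2 Nat.card_pos.ne'))]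
  set E := (Nat.card G - Nat.card (powEqOne G 2)) / 2 with hE
  rcases Int.emod_two_eq_zero_or_one (m / 2) with h2 | h2
  · have h4 : m % 4 = 1 := by
      have := Int.odd_iff.1 hodd
      omega
    rw [hone m hm h4]
    rcases Nat.even_or_odd E with h | h
    · rw [h.neg_one_pow, kroneckerSym_one_of_odd hodd, Units.val_one]
    · rw [h.neg_one_pow, kroneckerSym_neg_one_of_odd hodd, if_pos h4, Units.val_one]
  · have h4 : m % 4 = 3 := by
      have := Int.odd_iff.1 hodd
      omega
    -- Now -m ≡ 1 (mod 4), so the whole sign comes from inversion, which moves the elements outside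
    -- f₂(G) in pairs.
    have hmul : powPerm G m hm =
        powPerm G (-m) hm.neg_left * powPerm G (-1) isCoprime_neg_one_card := by
      ext g
      simp
    rw [hmul, Perm.sign_mul, hone (-m) hm.neg_left (by omega), sign_powPerm_neg_one, one_mul, ← hE]
    rcases Nat.even_or_odd E with h | h
    · rw [h.neg_one_pow, h.neg_one_pow, kroneckerSym_one_of_odd hodd, Units.val_one]
    · rw [h.neg_one_pow, h.neg_one_pow, kroneckerSym_neg_one_of_odd hodd, if_neg (by omega)]
      rfl

/-- A group of order `2 n` with `n` odd has a subgroup of index `2`. -/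
theorem exists_subgroup_index_two {G : Type*} [Group G] [Finite G] {n : ℕ} (hn : Odd n)
    (hG : Nat.card G = 2 * n) : ∃ N : Subgroup G, N.index = 2 := by
  classical
  have := Fintype.ofFinite G
  -- The sign of the regular representation: an involution acts without fixed points, as n
  -- transpositions, hence oddly.
  let f : G →* ℤˣ := (sign : Perm G →* ℤˣ).comp (MulAction.toPermHom G G)
  obtain ⟨t, ht⟩ := exists_prime_orderOf_dvd_card' (G := G) 2 (by rw [hG]; exact dvd_mul_right _ _)
  have ht1 : t ≠ 1 := by
    rintro rfl
    simp at ht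
  have ht2 : t * t = 1 := by rw [← pow_two, ← ht, pow_orderOf_eq_one]
  have hft : f t = -1 := by
    change sign (MulAction.toPermHom G G t) = -1
    rw [sign_of_pow_two_eq_one]
    · have : IsEmpty (Function.fixedPoints (MulAction.toPermHom G G t)) := by
        refine ⟨fun x => ht1 ?_⟩
        have : t * x.1 = x.1 := x.2
        simpa using this
      rw [← Nat.card_eq_fintype_card, ← Nat.card_eq_fintype_card, hG, Nat.card_of_isEmpty,
        Nat.sub_zero, Nat.mul_div_cancel_left _ two_pos, hn.neg_one_pow]
    · rw [← map_pow, pow_two, ht2, map_one]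
  refine ⟨f.ker, Subgroup.index_eq_two_iff.2 ⟨t, fun b => ?_⟩⟩
  rw [MonoidHom.mem_ker, MonoidHom.mem_ker, map_mul, hft]
  rcases Int.units_eq_one_or (f b) with h | h <;> rw [h] <;> decide

theorem sign_powPerm_eq_kroneckerSym_of_twice_odd {G : Type*} [Group G] [Fintype G] [DecidableEq G]
    (hG : IsTwiceOddWithInvolutions G) (m : ℤ) (hm : IsCoprime m (Nat.card G : ℤ)) :
    ((sign (powPerm G m hm) : ℤˣ) : ℤ) = kroneckerSym (dGroup G) m := by
  classical
  obtain ⟨⟨n, hn, hcard⟩, hinvol⟩ := hG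
  obtain ⟨N, hN⟩ := exists_subgroup_index_two hn hcard
  have hNcard : Nat.card N = n := by
    have := N.card_mul_index
    rw [hN, hcard] at this
    omega
  have hNodd : Odd (Nat.card N) := by rwa [hNcard]
  have hin : ∀ g ∈ N, g ^ 2 = 1 → g = 1 := by
    intro g hg h
    have := (pow_two_eq_one_iff_of_odd_card hNodd ⟨g, hg⟩).1 (Subtype.ext h)
    exact congrArg Subtype.val this
  have hmul : ∀ {a b : G}, a * b ∈ N ↔ (a ∈ N ↔ b ∈ N) := Subgroup.mul_mem_iff_of_index_two hN
  have hout : ∀ g ∉ N, g ^ 2 = 1 := by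
    intro g hg
    -- Squares lie in N, and an element of odd order is a power of its square up to inversion, so
    -- elements outside N have even order.
    have : Even (orderOf g) := by
      rw [← Nat.not_odd_iff_even]
      rintro ⟨k, hk⟩
      apply hg
      have h1 : g ^ 2 ∈ N := Subgroup.sq_mem_of_index_two hN g
      have h2 : (g ^ 2) ^ k * g = 1 := by rw [← pow_mul, ← pow_succ, ← hk, pow_orderOf_eq_one]
      exact (hmul.1 (h2 ▸ N.one_mem)).1 (N.pow_mem h1 k)
    rw [← hinvol g this, pow_orderOf_eq_one]
  have hpos : 0 < n := hn.pos
  have hodd : Odd m := odd_of_isCoprime_of_even hm (by rw [hcard]; exact even_two_mul n)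
  have hmn : IsCoprime m (n : ℤ) := by
    rw [hcard, Nat.cast_mul] at hm
    exact hm.of_mul_right_right
  have hf2 : Nat.card (powEqOne G 2) = n + 1 := by
    have h1 : powEqOne G 2 = ((N : Set G) \ {1})ᶜ := by
      ext g
      simp only [powEqOne, Set.mem_ofPred_eq, Set.mem_compl_iff, Set.mem_sdiff, SetLike.mem_coe,
        Set.mem_singleton_iff, not_and, not_not]
      constructor
      · exact fun h hg => hin g hg h
      · intro h
        by_cases hg : g ∈ N
        · rw [h hg, one_pow]
        · exact hout g hg
    have h2 := Set.ncard_add_ncard_compl ((N : Set G) \ {1})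
    rw [← h1, Set.ncard_sdiff_singleton_of_mem N.one_mem, ← Nat.card_coe_set_eq,
      ← Nat.card_coe_set_eq, hcard] at h2
    change Nat.card N - 1 + _ = _ at h2
    omega
  have hsyl : numSylowTwo G = n := by
    obtain ⟨P⟩ : Nonempty (Sylow 2 G) := inferInstance
    have hP : Nat.card P = 2 := by
      have h1 : (Nat.card G).factorization 2 = 1 := by
        rw [hcard, Nat.factorization_mul two_ne_zero hpos.ne', Finsupp.add_apply,
          Nat.prime_two.factorization_self, Nat.factorization_eq_zero_of_not_dvd]
        exact fun h => Nat.not_even_iff_odd.2 hn (even_iff_two_dvd.2 h)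
      rw [P.card_eq_multiplicity, h1, pow_one]
    obtain ⟨t, ht1, ht⟩ := (Nat.card_eq_two_iff' (1 : P)).1 hP
    have ht2 : t.1 ^ 2 = 1 := by
      have : t ^ Nat.card (P : Subgroup G) = 1 := pow_card_eq_one'
      rw [hP] at this
      exact congrArg Subtype.val this
    have htN : t.1 ∉ N := fun h => ht1 (Subtype.ext (hin _ h ht2))
    -- Here P = {1, t}, so a normalizing g commutes with t. Exactly one of g and g t lies in N, and
    -- both square to 1, so that one is 1.
    have hnorm : Subgroup.normalizer (P : Set G) = P := by
      refine le_antisymm (fun g hg => ?_) Subgroup.le_normalizer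
      have h1 : g * t.1 * g⁻¹ ∈ (P : Subgroup G) := (Subgroup.mem_normalizer_iff.1 hg t.1).1 t.2
      have h2 : (⟨g * t.1 * g⁻¹, h1⟩ : P) = t := ht _ fun h => ht1 (Subtype.ext (by
        have := congrArg Subtype.val h
        simpa using this))
      have hc : Commute g t.1 := mul_inv_eq_iff_eq_mul.1 (congrArg Subtype.val h2)
      by_cases hgN : g ∈ N
      · have h3 := hout (g * t.1) (by rw [hmul]; simp [hgN, htN])
        rw [hc.mul_pow, ht2, mul_one] at h3
        rw [hin g hgN h3]
        exact P.one_mem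
      · have h3 : g * t.1 = 1 := hin _ (by rw [hmul]; simp [hgN, htN])
          (by rw [hc.mul_pow, ht2, hout g hgN, mul_one])
        rw [eq_inv_of_mul_eq_one_left h3]
        exact inv_mem t.2
    have h1 := (P : Subgroup G).card_mul_index
    rw [numSylowTwo, P.card_eq_index_normalizer, hnorm]
    change Nat.card P * _ = _ at h1
    rw [hP, hcard] at h1
    omega
  have hsign : sign (powPerm G m hm) = sign (powPerm N m (by rwa [hNcard])) := by
    have h1 : ∀ g, powPerm G m hm g ∈ N ↔ g ∈ N := by
      intro g
      constructor
      · intro h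
        by_contra hg
        rw [powPerm_apply, zpow_eq_self_of_sq_eq_one (hout g hg) hodd] at h
        exact hg h
      · exact fun h => N.zpow_mem h m
    rw [← sign_subtypePerm (powPerm G m hm) h1 fun g hg => by
      by_contra h
      exact hg (zpow_eq_self_of_sq_eq_one (hout g h) hodd)]
    congr 1
    exact Perm.ext fun x => rfl
  obtain ⟨k, rfl⟩ := hn
  -- Here n₂(G) = n, so ε(G) = 1. Dividing (2n) ^ (n + 1), a square, by n leaves n times a square.
  have hd : dGroup G = ((-1) ^ ((2 * k + 1 - 1) / 2) * ((2 * k + 1 : ℕ) : ℤ)) *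
      ((2 ^ (k + 1) * ((2 * k + 1 : ℕ) : ℤ) ^ k)) ^ 2 := by
    have h1 : (2 * (2 * k + 1)) ^ (2 * k + 1 + 1) / (2 * k + 1) =
        (2 * k + 1) * (2 ^ (k + 1) * (2 * k + 1) ^ k) ^ 2 := by
      apply Nat.div_eq_of_eq_mul_left hpos
      have : ∀ a : ℕ, (2 * a) ^ (2 * k + 1 + 1) = a * (2 ^ (k + 1) * a ^ k) ^ 2 * a := fun a => by
        ring
      exact this _
    have h2 : (2 * (2 * k + 1) - (2 * k + 1 + 1)) / 2 = (2 * k + 1 - 1) / 2 := by omega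
    rw [dGroup, epsGroup, hsyl, hf2, hcard, if_pos rfl, pow_one, h1, h2]
    push_cast
    ring
  rw [hd, kroneckerSym_mul_sq _ _ hodd, hsign, sign_powPerm_of_odd N hNodd, hNcard,
    kroneckerSym_neg_one_pow_half_mul_self ⟨k, rfl⟩ hmn]
  · refine IsCoprime.mul_left (IsCoprime.pow_left ?_) (IsCoprime.pow_left hmn.symm)
    rw [hcard, Nat.cast_mul] at hm
    exact hm.of_mul_right_left.symm
  · positivity

theorem theorem2 (G : Type*) [Group G] [Fintype G] [DecidableEq G]
    (hG : IsOddTimesTwoGroup G ∨ IsTwiceOddWithInvolutions G)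
    (m : ℤ) (hm : IsCoprime m (Nat.card G : ℤ)) :
    ((Equiv.Perm.sign (powPerm G m hm) : ℤˣ) : ℤ) = kroneckerSym (dGroup G) m := by
  rcases hG with ⟨K, H, _, _, hK, hH, ⟨e⟩⟩ | hG
  · exact sign_powPerm_eq_kroneckerSym_of_prod hK hH e m hm
  · exact sign_powPerm_eq_kroneckerSym_of_twice_odd hG m hm
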